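/- **Setting.** Let $\mathbb R^{3\times3}_{sym}$ be the space of real symmetric $3\times 3$ matrices with $A:B=\sum_{i,j}A_{ij}B_{ij}$ and $\|A\|=\sqrt{A:A}$, and let $I$ be the identity. For $\sigma\in\mathbb R^{3\times3}_{sym}$ put $$p(\sigma)=\tfrac13 I:\sigma,\quad s(\sigma)=\sigma-p(\sigma)I,\quad \varrho(\sigma)=\|s(\sigma)\|,\quad J_2=\tfrac12 s:s,\quad J_3=\tfrac13 s^3:I,\quad \theta(\sigma)=\tfrac13\arccos\Big(\tfrac{3\sqrt3}{2}\tfrac{J_3}{J_2^{3/2}}\Big),$$ and $\varrho_e(\sigma)=\varrho(\sigma)\,r_e(\cos\theta(\sigma))$ (with $\varrho_e(\sigma)=0$ if $\varrho(\sigma)=0$), where $$r_e(c)=\frac{4(1-e^2)c^2+(2e-1)^2}{2(1-e^2)c+(2e-1)\sqrt{4(1-e^2)c^2+5e^2-4e}} .$$ Let $\partial\varrho(\sigma)=\{n\in\mathbb R^{3\times3}_{sym}:\ \varrho(\tau)\ge\varrho(\sigma)+n:(\tau-\sigma)\ \ \forall\tau\in\mathbb R^{3\times3}_{sym}\}$.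 The parameters are $K,G,\bar f_c,m_0,A_g,B_g>0$, $\bar f_t\ge0$ and $e\in[\tfrac12,1]$. Put $\mathbb D_e:\varepsilon=K(I:\varepsilon)I+2G\,s(\varepsilon)$, $m_g(p)=A_gB_g\bar f_c\exp\big(\frac{p-\bar f_t/3}{B_g\bar f_c}\big)$, so that $m_g'(p)=A_g\exp\big(\frac{p-\bar f_t/3}{B_g\bar f_c}\big)$, and $$f(\sigma)=\frac32\Big(\frac{\varrho(\sigma)}{\bar f_c}\Big)^2+m_0\Big(\frac{\varrho_e(\sigma)}{\sqrt6\,\bar f_c}+\frac{p(\sigma)}{\bar f_c}\Big)-1 .$$ **Incremental problem** of the simplified Jirásek–Grassl model. Given the strain $\varepsilon$ and the previous plastic strain $\varepsilon^p$ in $\mathbb R^{3\times3}_{sym}$, put $\sigma^{tr}=\mathbb D_e:(\varepsilon-\varepsilon^p)$ and find $\sigma\in\mathbb R^{3\times3}_{sym}$ and $\triangle\lambda\in\mathbb R$ such that, for some $\hat n\in\partial\varrho(\sigma)$, $$\sigma=\sigma^{tr}-\triangle\lambda\Big[K\frac{m_g'(p(\sigma))}{\bar f_c}I+2G\Big(\frac{3\varrho(\sigma)}{\bar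 f_c^2}+\frac{m_0}{\sqrt6\,\bar f_c}\Big)\hat n\Big],\qquad \triangle\lambda\ge0,\quad f(\sigma)\le0,\quad \triangle\lambda\,f(\sigma)=0 .$$ The implicit stress–strain operator is $T(\varepsilon)=T(\varepsilon;\varepsilon^p):=\sigma$, the stress component of the solution. **Strong semismoothness.** A map $F:X\to Y$ between finite dimensional normed spaces is strongly semismooth at $x$ if it is Lipschitz in a neighborhood of $x$, has one-sided directional derivatives at $x$ in all directions, and there are $C\in\mathbb R$ and $\delta>0$ with $\|F(x+h)-F(x)-Vh\|\le C\|h\|^2$ for all $h$ with $\|h\|<\delta$ and all $V\in\partial F(x+h)$. Here $\partial F(y)$ is Clarke's generalized Jacobian, the convex hull of all limits of $DF(y_n)$ along sequences $y_n\to y$ of points at which $F$ is Fréchet differentiable. **Theorem.** Let $\varepsilon^p\in\mathbb R^{3\times3}_{sym}$. For every $\varepsilon\in\mathbb R^{3\times3}_{sym}$ the incremental problem has exactly one solution $(\sigma,\triangle\lambda)$, so that $T(\cdot\,;\varepsilon^p)$ is well defined, and the function $\varepsilon\mapsto T(\varepsilon;\varepsilon^p)$ is strongly semismooth at every point of $\mathbb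 R^{3\times3}_{sym}$. -/

import Mathlib

open scoped Matrix.Norms.Frobenius

noncomputable section

/-! Strong semismoothness of maps between finite dimensional normed spaces. -/

namespace Semismooth

variable {X Y : Type*} [NormedAddCommGroup X] [NormedSpace ℝ X]
  [NormedAddCommGroup Y] [NormedSpace ℝ Y]

/-- The set of all limits of derivatives `DF (u n)` along sequences `u n → x` of points at which
`F` is Fréchet differentiable. -/
def limitingJacobian (F : X → Y) (x : X) : Set (X →L[ℝ] Y) :=
  {V | ∃ u : ℕ → X, Filter.Tendsto u Filter.atTop (nhds x) ∧
    (∀ n, DifferentiableAt ℝ F (u n)) ∧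
    Filter.Tendsto (fun n => fderiv ℝ F (u n)) Filter.atTop (nhds V)}

/-- Clarke's generalized Jacobian `∂F(x)`. -/
def clarkeJacobian (F : X → Y) (x : X) : Set (X →L[ℝ] Y) :=
  convexHull ℝ (limitingJacobian F x)

/-- `F` is Lipschitz continuous in a neighborhood of `x`. -/
def LipschitzNear (F : X → Y) (x : X) : Prop :=
  ∃ C : NNReal, ∃ U ∈ nhds x, LipschitzOnWith C F U

/-- The one-sided directional derivatives `F'(x; h)` exist for all directions `h`. -/
def DirectionallyDifferentiableAt (F : X → Y) (x : X) : Prop :=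
  ∀ h : X, ∃ d : Y,
    Filter.Tendsto (fun t : ℝ => t⁻¹ • (F (x + t • h) - F x)) (nhdsWithin 0 (Set.Ioi 0)) (nhds d)

/-- `F` is strongly semismooth at `x`: it is Lipschitz near `x`, directionally differentiable
at `x`, and `F (x + h) - F x - V h = O(‖h‖²)` as `h → 0`, uniformly in `V ∈ ∂F(x + h)`. -/
def StronglySemismoothAt (F : X → Y) (x : X) : Prop :=
  LipschitzNear F x ∧ DirectionallyDifferentiableAt F x ∧
    ∃ C : ℝ, ∃ δ > 0, ∀ h : X, ‖h‖ < δ → ∀ V ∈ clarkeJacobian F (x + h),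
      ‖F (x + h) - F x - V h‖ ≤ C * ‖h‖ ^ 2

/-- Strong semismoothness on a set: at every one of its points. -/
def StronglySemismoothOn (F : X → Y) (O : Set X) : Prop :=
  ∀ x ∈ O, StronglySemismoothAt F x

end Semismooth

/-! Symmetric second order tensors and their invariants. -/

namespace Plasticity

/-- The symmetric `3 × 3` matrices, as a subspace of all matrices with the Frobenius norm. -/
def symSubmodule : Submodule ℝ (Matrix (Fin 3) (Fin 3) ℝ) where
  carrier := {A | A.IsSymm}
  add_mem' := fun hA hB => Matrix.IsSymm.add hA hB
  zero_mem' := Matrix.isSymm_zero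
  smul_mem' := fun c _ hA => Matrix.IsSymm.smul hA c

/-- The space of symmetric `3 × 3` tensors. -/
abbrev Sym3 : Type := symSubmodule

/-- The identity tensor `I`. -/
def idTensor : Sym3 := ⟨1, Matrix.isSymm_one⟩

/-- The double contraction `A : B`. -/
def ddot (A B : Sym3) : ℝ := ∑ i, ∑ j, A.1 i j * B.1 i j

/-- The hydrostatic pressure `p(σ) = (I : σ) / 3`. -/
def pressure (σ : Sym3) : ℝ := ddot idTensor σ / 3

/-- The deviatoric part `s(σ) = σ - p(σ) I`. -/
def deviator (σ : Sym3) : Sym3 := σ - pressure σ • idTensor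

/-- The invariant `ϱ(σ) = ‖s(σ)‖ = √(s : s)`. -/
def rho (σ : Sym3) : ℝ := ‖deviator σ‖

/-- `J₂ = (s : s) / 2`. -/
def J2 (σ : Sym3) : ℝ := ddot (deviator σ) (deviator σ) / 2

/-- `J₃ = (s³ : I) / 3`. -/
def J3 (σ : Sym3) : ℝ := ((deviator σ).1 ^ 3).trace / 3

/-- The Lode angle `θ(σ) ∈ [0, π/3]`. Its value when `ϱ(σ) = 0` is irrelevant, because it is
only used in the product `ϱ r_e(cos θ)`. -/
def lodeAngle (σ : Sym3) : ℝ :=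
  Real.arccos (3 * √3 / 2 * (J3 σ / J2 σ ^ (3 / 2 : ℝ))) / 3

/-- The function `r_e` with excentricity `e`, as a function of `c = cos θ`. -/
def rExc (e c : ℝ) : ℝ :=
  (4 * (1 - e ^ 2) * c ^ 2 + (2 * e - 1) ^ 2) /
    (2 * (1 - e ^ 2) * c + (2 * e - 1) * √(4 * (1 - e ^ 2) * c ^ 2 + 5 * e ^ 2 - 4 * e))

/-- The invariant `ϱ_e(σ) = ϱ(σ) r_e(cos θ(σ))`. -/
def rhoExc (e : ℝ) (σ : Sym3) : ℝ := rho σ * rExc e (Real.cos (lodeAngle σ))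

/-- The convex subdifferential `∂ϱ(σ)`. -/
def subdiffRho (σ : Sym3) : Set Sym3 :=
  {n | ∀ τ : Sym3, rho σ + ddot n (τ - σ) ≤ rho τ}

/-- Material parameters of the simplified (perfectly plastic) Jirásek–Grassl model. -/
structure JGModel where
  /-- bulk modulus -/
  K : ℝ
  /-- shear modulus -/
  G : ℝ
  /-- uniaxial compressive strength -/
  fc : ℝ
  /-- uniaxial tensile strength -/
  ft : ℝ
  /-- friction parameter -/
  m0 : ℝ
  /-- first parameter of the plastic potential -/
  Ag : ℝ
  /-- second parameter of the plastic potential -/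
  Bg : ℝ
  /-- excentricity -/
  e : ℝ
  K_pos : 0 < K
  G_pos : 0 < G
  fc_pos : 0 < fc
  ft_nonneg : 0 ≤ ft
  m0_pos : 0 < m0
  Ag_pos : 0 < Ag
  Bg_pos : 0 < Bg
  half_le_e : 1 / 2 ≤ e
  e_le_one : e ≤ 1

namespace JGModel

variable (M : JGModel)

/-- The elastic law `D_e : ε = K (I : ε) I + 2 G dev ε`. -/
def elastic (ε : Sym3) : Sym3 :=
  (M.K * ddot idTensor ε) • idTensor + (2 * M.G) • deviator ε

/-- The yield function in terms of the invariants `p`, `ϱ`, `ϱ_e`. -/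
def yieldHat (p ϱ ϱe : ℝ) : ℝ :=
  3 / 2 * (ϱ / M.fc) ^ 2 + M.m0 * (ϱe / (√6 * M.fc) + p / M.fc) - 1

/-- The yield function `f(σ)`. -/
def yieldFun (σ : Sym3) : ℝ := M.yieldHat (pressure σ) (rho σ) (rhoExc M.e σ)

/-- The volumetric part `m_g(p)` of the plastic pseudo-potential
`g = (3/2) (ϱ/f_c)² + m₀ ϱ/(√6 f_c) + m_g(p)/f_c`. -/
def mg (p : ℝ) : ℝ :=
  M.Ag * M.Bg * M.fc * Real.exp ((p - M.ft / 3) / (M.Bg * M.fc))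

/-- The plastic pseudo-potential in terms of the invariants `p`, `ϱ`. -/
def potentialHat (p ϱ : ℝ) : ℝ :=
  3 / 2 * (ϱ / M.fc) ^ 2 + M.m0 * ϱ / (√6 * M.fc) + M.mg p / M.fc

/-- The partial derivative `∂ĝ/∂p = m_g'(p) / f_c`. -/
def gV (p : ℝ) : ℝ :=
  M.Ag * Real.exp ((p - M.ft / 3) / (M.Bg * M.fc)) / M.fc

/-- The partial derivative `∂ĝ/∂ϱ`. -/
def gRho (ϱ : ℝ) : ℝ := 3 * ϱ / M.fc ^ 2 + M.m0 / (√6 * M.fc)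

theorem hasDerivAt_potentialHat_p (p ϱ : ℝ) :
    HasDerivAt (fun x => M.potentialHat x ϱ) (M.gV p) p := by
  have hB := M.Bg_pos.ne'
  have hf := M.fc_pos.ne'
  have h1 : HasDerivAt (fun x : ℝ => (x - M.ft / 3) / (M.Bg * M.fc)) (1 / (M.Bg * M.fc)) p :=
    ((hasDerivAt_id p).sub_const _).div_const _
  have h2 := (((h1.exp).const_mul (M.Ag * M.Bg * M.fc)).div_const M.fc).const_add
    (3 / 2 * (ϱ / M.fc) ^ 2 + M.m0 * ϱ / (√6 * M.fc))
  refine h2.congr_deriv ?_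
  unfold gV
  field_simp

theorem hasDerivAt_potentialHat_rho (p ϱ : ℝ) :
    HasDerivAt (fun x => M.potentialHat p x) (M.gRho ϱ) ϱ := by
  have hf := M.fc_pos.ne'
  have h1 : HasDerivAt (fun x : ℝ => 3 / 2 * (x / M.fc) ^ 2) (3 * ϱ / M.fc ^ 2) ϱ := by
    have := ((((hasDerivAt_id ϱ).div_const M.fc).pow 2).const_mul (3 / 2 : ℝ))
    refine this.congr_deriv ?_
    simp
    field_simp
  have h2 : HasDerivAt (fun x : ℝ => M.m0 * x / (√6 * M.fc)) (M.m0 / (√6 * M.fc)) ϱ := by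
    simpa using ((hasDerivAt_id ϱ).const_mul M.m0).div_const (√6 * M.fc)
  exact (h1.add h2).add_const _

/-- The trial stress `σ^tr = D_e : (ε - ε^p)`, where `ε` is the strain at the current time step
and `εp` the plastic strain at the previous one. -/
def trialStress (εp ε : Sym3) : Sym3 := M.elastic (ε - εp)

/-- One step of the implicit Euler method: `(σ, Δλ)` solves the incremental constitutive problem
with strain `ε` and previous plastic strain `εp`. -/
def IsStepSolution (εp ε σ : Sym3) (Δl : ℝ) : Prop :=
  (∃ n ∈ subdiffRho σ,
    σ = M.trialStress εp ε -
      Δl • ((M.K * M.gV (pressure σ)) • idTensor + (2 * M.G * M.gRho (rho σ)) • n)) ∧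
  0 ≤ Δl ∧ M.yieldFun σ ≤ 0 ∧ Δl * M.yieldFun σ = 0

/-- The implicit stress–strain operator `ε ↦ T(ε; ε^p)`: the stress component of the solution
of the incremental constitutive problem. -/
def stressStrain (εp ε : Sym3) : Sym3 :=
  Classical.epsilon fun σ : Sym3 => ∃ Δl : ℝ, M.IsStepSolution εp ε σ Δl

end JGModel

end Plasticity

end

/-! The incremental problem has one scalar unknown, the pressure `p` of the new stress. Let `z` be
the trial stress. The volumetric part of the flow rule gives the plastic multiplier as a smooth
function of `(z, p)`. The deviatoric part, combined with the description of `∂ϱ`, says that the new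
deviator is a nonnegative multiple `κ` of the deviator of `z`, with `κ` explicit in `ϱ(z)` and the
multiplier (`eq_returnStress_of_flow`, `exists_flow_of_eq_multiplier`). A larger `p` means a smaller
multiplier, hence a larger `κ`; since `ϱ` and `ϱ_e` are positively homogeneous in the deviator, `f`
grows along this path at rate at least `m₀ / f_c` (`yieldFun_returnStress_mono`). So `f` has a
single zero on the path, and complementarity says that `p` is the minimum of that zero and the trial
pressure (`isStepSolution_iff`). This gives existence and uniqueness.

Strong semismoothness is obtained without handling Clarke Jacobians of compositions, through
`ChordRegularAt`. Dividing its chord bound by `1 - s` and letting `s → 1` yields the semismoothness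
estimate at points of differentiability, and the estimate survives limits and convex combinations
(`stronglySemismoothAt`). The condition holds for `C²` maps and for Lipschitz maps that are
homogeneous about the point, and it passes to compositions and to solutions of strongly monotone
scalar equations (`implicit`).

Two ingredients are not covered by this calculus. The product `ϱ cos θ` is a multiple of the largest
eigenvalue of the deviator (`cos_lodeAngle`), which is chord regular by convexity and a spectral gap
(`chordRegularAt_topEig`). The factor `κ` is not continuous where the deviator and the multiplier
both vanish, but its products with the deviator, `ϱ` and `ϱ_e` are Lipschitz and homogeneous there
(`chordRegularAt_shrink`). -/

noncomputable section

/-! ### Calculus of the chord condition and its link to strong semismoothness. -/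

namespace Semismooth

variable {X Y Z : Type*} [NormedAddCommGroup X] [NormedSpace ℝ X]
  [NormedAddCommGroup Y] [NormedSpace ℝ Y] [NormedAddCommGroup Z] [NormedSpace ℝ Z]

/-- `F` is Lipschitz near `x`, and on short segments issuing from `x` it differs from its chord by
at most a constant times `(1 - s) ‖h‖²`. For locally Lipschitz maps this derivative-free condition
implies strong semismoothness, and it is stable under composition and implicit functions. -/
def ChordRegularAt (F : X → Y) (x : X) : Prop :=
  ∃ C : ℝ, 0 ≤ C ∧ ∃ δ > 0,
    (∀ y z : X, ‖y - x‖ < δ → ‖z - x‖ < δ → ‖F y - F z‖ ≤ C * ‖y - z‖) ∧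
    ∀ h : X, ‖h‖ < δ → ∀ s ∈ Set.Icc (0 : ℝ) 1,
      ‖F (x + s • h) - F x - s • (F (x + h) - F x)‖ ≤ C * (1 - s) * ‖h‖ ^ 2

namespace ChordRegularAt

theorem of_bounds {F : X → Y} {x : X} {L C δ₁ δ₂ : ℝ} (hδ₁ : 0 < δ₁) (hδ₂ : 0 < δ₂)
    (hL : ∀ y z : X, ‖y - x‖ < δ₁ → ‖z - x‖ < δ₁ → ‖F y - F z‖ ≤ L * ‖y - z‖)
    (hC : ∀ h : X, ‖h‖ < δ₂ → ∀ s ∈ Set.Icc (0 : ℝ) 1,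
      ‖F (x + s • h) - F x - s • (F (x + h) - F x)‖ ≤ C * (1 - s) * ‖h‖ ^ 2) :
    ChordRegularAt F x := by
  refine ⟨max 0 (max L C), le_max_left _ _, min δ₁ δ₂, lt_min hδ₁ hδ₂, ?_, ?_⟩
  · intro y z hy hz
    refine (hL y z (hy.trans_le (min_le_left _ _)) (hz.trans_le (min_le_left _ _))).trans ?_
    gcongr
    exact (le_max_left _ _).trans (le_max_right _ _)
  · intro h hh s hs
    refine (hC h (hh.trans_le (min_le_right _ _)) s hs).trans ?_
    have := sub_nonneg.2 hs.2
    gcongr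
    exact (le_max_right _ _).trans (le_max_right _ _)

theorem lipschitzNear {F : X → Y} {x : X} (hF : ChordRegularAt F x) : LipschitzNear F x := by
  obtain ⟨C, hC, δ, hδ, hL, -⟩ := hF
  refine ⟨⟨C, hC⟩, Metric.ball x δ, Metric.ball_mem_nhds x hδ, ?_⟩
  refine LipschitzOnWith.of_dist_le_mul fun y hy z hz => ?_
  rw [dist_eq_norm, dist_eq_norm]
  exact hL y z (by simpa [dist_eq_norm] using hy) (by simpa [dist_eq_norm] using hz)

theorem continuousAt {F : X → Y} {x : X} (hF : ChordRegularAt F x) : ContinuousAt F x := by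
  obtain ⟨C, U, hU, hL⟩ := hF.lipschitzNear
  exact hL.continuousOn.continuousAt hU

theorem congr {F G : X → Y} {x : X} (hF : ChordRegularAt F x) (h : F =ᶠ[nhds x] G) :
    ChordRegularAt G x := by
  obtain ⟨C, -, δ, hδ, hL, hc⟩ := hF
  obtain ⟨η, hη, hFG⟩ := Metric.eventually_nhds_iff.1 h
  have e : ∀ y, ‖y - x‖ < min δ η → F y = G y := fun y hy =>
    hFG (by rw [dist_eq_norm]; exact hy.trans_le (min_le_right _ _))
  have hm : 0 < min δ η := lt_min hδ hη
  refine of_bounds (L := C) (C := C) hm hm ?_ ?_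
  · intro y z hy hz
    rw [← e y hy, ← e z hz]
    exact hL y z (hy.trans_le (min_le_left _ _)) (hz.trans_le (min_le_left _ _))
  · intro v hv s hs
    have hsv : ‖s • v‖ ≤ ‖v‖ := by
      rw [norm_smul, Real.norm_of_nonneg hs.1]
      exact mul_le_of_le_one_left (norm_nonneg _) hs.2
    rw [← e x (by simpa using hm), ← e (x + v) (by simpa using hv),
      ← e (x + s • v) (by simpa using hsv.trans_lt hv)]
    exact hc v (hv.trans_le (min_le_left _ _)) s hs

/-- The value `F (x + s • v)` is compared with the point `F x + s • k` on the chord of `F`. The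
Lipschitz bound of `G` absorbs the chord error of `F`, and the chord bound of `G` in direction `k`
does the rest; both errors carry the factor `1 - s`. -/
theorem comp {G : Y → Z} {F : X → Y} {x : X} (hG : ChordRegularAt G (F x))
    (hF : ChordRegularAt F x) : ChordRegularAt (fun y => G (F y)) x := by
  have hcont := hF.continuousAt
  obtain ⟨A, hA, δ, hδ, hGL, hGc⟩ := hG
  obtain ⟨B, hB, η, hη, hFL, hFc⟩ := hF
  obtain ⟨ζ, hζ, hFδ⟩ := Metric.continuousAt_iff.1 hcont δ hδ
  have near : ∀ y, ‖y - x‖ < min η ζ → ‖F y - F x‖ < δ := fun y hy => by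
    rw [← dist_eq_norm]
    exact hFδ (by rw [dist_eq_norm]; exact hy.trans_le (min_le_right _ _))
  have hm : 0 < min η ζ := lt_min hη hζ
  refine of_bounds (L := A * B) (C := A * B + A * B ^ 2) hm hm ?_ ?_
  · intro y z hy hz
    refine (hGL _ _ (near y hy) (near z hz)).trans ?_
    rw [mul_assoc]
    gcongr
    exact hFL y z (hy.trans_le (min_le_left _ _)) (hz.trans_le (min_le_left _ _))
  · intro v hv s hs
    have hs1 := sub_nonneg.2 hs.2
    have hsv : ‖s • v‖ ≤ ‖v‖ := by
      rw [norm_smul, Real.norm_of_nonneg hs.1]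
      exact mul_le_of_le_one_left (norm_nonneg _) hs.2
    have hvη := hv.trans_le (min_le_left _ _)
    set k := F (x + v) - F x with hk
    have hkδ : ‖k‖ < δ := near _ (by simpa using hv)
    have hkv : ‖k‖ ≤ B * ‖v‖ := by
      simpa using hFL (x + v) x (by simpa using hvη) (by simpa using hη)
    have hsk : ‖s • k‖ ≤ ‖k‖ := by
      rw [norm_smul, Real.norm_of_nonneg hs.1]
      exact mul_le_of_le_one_left (norm_nonneg _) hs.2
    have h1 := hGc k hkδ s hs
    have h2 := hGL (F (x + s • v)) (F x + s • k) (near _ (by simpa using hsv.trans_lt hv))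
      (by simpa using hsk.trans_lt hkδ)
    have h3 := hFc v hvη s hs
    have e1 : F x + k = F (x + v) := by rw [hk]; abel
    rw [e1] at h1
    calc ‖G (F (x + s • v)) - G (F x) - s • (G (F (x + v)) - G (F x))‖
        = ‖(G (F (x + s • v)) - G (F x + s • k)) +
            (G (F x + s • k) - G (F x) - s • (G (F (x + v)) - G (F x)))‖ := by congr 1; abel
      _ ≤ A * ‖F (x + s • v) - (F x + s • k)‖ + A * (1 - s) * ‖k‖ ^ 2 :=
          (norm_add_le _ _).trans (add_le_add h2 h1)
      _ ≤ A * (B * (1 - s) * ‖v‖ ^ 2) + A * (1 - s) * (B * ‖v‖) ^ 2 := by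
          gcongr
          rwa [← sub_sub]
      _ = (A * B + A * B ^ 2) * (1 - s) * ‖v‖ ^ 2 := by ring

theorem prodMk {F : X → Y} {G : X → Z} {x : X} (hF : ChordRegularAt F x)
    (hG : ChordRegularAt G x) : ChordRegularAt (fun y => (F y, G y)) x := by
  obtain ⟨A, hA, δ, hδ, hFL, hFc⟩ := hF
  obtain ⟨B, hB, η, hη, hGL, hGc⟩ := hG
  refine of_bounds (L := max A B) (C := max A B) (lt_min hδ hη) (lt_min hδ hη) ?_ ?_
  · intro y z hy hz
    rw [Prod.mk_sub_mk, Prod.norm_mk]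
    refine max_le ?_ ?_
    · refine (hFL y z (hy.trans_le (min_le_left _ _)) (hz.trans_le (min_le_left _ _))).trans ?_
      gcongr
      exact le_max_left _ _
    · refine (hGL y z (hy.trans_le (min_le_right _ _)) (hz.trans_le (min_le_right _ _))).trans ?_
      gcongr
      exact le_max_right _ _
  · intro v hv s hs
    have hs1 := sub_nonneg.2 hs.2
    simp only [Prod.mk_sub_mk, Prod.smul_mk, Prod.norm_mk]
    refine max_le ?_ ?_
    · refine (hFc v (hv.trans_le (min_le_left _ _)) s hs).trans ?_
      gcongr
      exact le_max_left _ _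
    · refine (hGc v (hv.trans_le (min_le_right _ _)) s hs).trans ?_
      gcongr
      exact le_max_right _ _

/-- The derivative is Lipschitz near `x`, so by the mean value inequality `F` differs from its
linearization at `x` by `O(‖v‖)` times the length of the increment. Using this for the increments
`v` and `(1 - s) • v`, both ending at `x + v`, produces the factor `1 - s`. -/
theorem of_contDiffAt {F : X → Y} {x : X} (hF : ContDiffAt ℝ 2 F x) : ChordRegularAt F x := by
  obtain ⟨K, U, hU, hK⟩ := (hF.of_le (m := 1) (by norm_num)).exists_lipschitzOnWith
  have hd : ContDiffAt ℝ 1 (fderiv ℝ F) x := hF.fderiv_right (by norm_num)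
  obtain ⟨L, W, hW, hL⟩ := hd.exists_lipschitzOnWith
  have hdiff : ∀ᶠ y in nhds x, DifferentiableAt ℝ F y :=
    (hF.eventually (by simp)).mono fun y hy => hy.differentiableAt (by norm_num)
  obtain ⟨δ, hδ, hball⟩ := Metric.mem_nhds_iff.1 (Filter.inter_mem (Filter.inter_mem hU hW) hdiff)
  refine of_bounds (L := K) (C := 2 * L) hδ hδ ?_ ?_
  · intro y z hy hz
    simpa [dist_eq_norm] using hK.dist_le_mul y (hball (by simpa [dist_eq_norm] using hy)).1.1 z
      (hball (by simpa [dist_eq_norm] using hz)).1.1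
  · intro v hv s hs
    have hs1 := sub_nonneg.2 hs.2
    have hsv : ‖s • v‖ ≤ ‖v‖ := by
      rw [norm_smul, Real.norm_of_nonneg hs.1]
      exact mul_le_of_le_one_left (norm_nonneg _) hs.2
    have hsub : ∀ y ∈ Metric.closedBall x ‖v‖, y ∈ Metric.ball x δ := fun y hy =>
      Metric.closedBall_subset_ball hv hy
    set D := fderiv ℝ F x with hD
    have lip : ∀ y ∈ Metric.closedBall x ‖v‖, ∀ z ∈ Metric.closedBall x ‖v‖,
        ‖F z - F y - D (z - y)‖ ≤ L * ‖v‖ * ‖z - y‖ := by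
      intro y hy z hz
      refine (convex_closedBall x ‖v‖).norm_image_sub_le_of_norm_fderiv_le' (𝕜 := ℝ) ?_ ?_ hy hz
      · exact fun w hw => (hball (hsub w hw)).2
      · intro w hw
        have := hL.dist_le_mul w (hball (hsub w hw)).1.2 x (hball (Metric.mem_ball_self hδ)).1.2
        rw [dist_eq_norm] at this
        refine this.trans ?_
        gcongr
        exact hw
    have h0 : x ∈ Metric.closedBall x ‖v‖ := by simp
    have h1 : x + v ∈ Metric.closedBall x ‖v‖ := by simp
    have h2 : x + s • v ∈ Metric.closedBall x ‖v‖ := by simpa using hsv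
    have k1 := lip x h0 (x + v) h1
    have k2 := lip (x + s • v) h2 (x + v) h1
    have e1 : x + v - x = v := by abel
    have e2 : x + v - (x + s • v) = (1 - s) • v := by module
    rw [e1] at k1
    rw [e2, norm_smul, Real.norm_of_nonneg hs1] at k2
    calc ‖F (x + s • v) - F x - s • (F (x + v) - F x)‖
        = ‖(1 - s) • (F (x + v) - F x - D v) -
            (F (x + v) - F (x + s • v) - D ((1 - s) • v))‖ := by
          congr 1
          rw [map_smul]
          module
      _ ≤ (1 - s) * (L * ‖v‖ * ‖v‖) + L * ‖v‖ * ((1 - s) * ‖v‖) := by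
          refine (norm_sub_le _ _).trans (add_le_add ?_ k2)
          rw [norm_smul, Real.norm_of_nonneg hs1]
          gcongr
      _ = 2 * L * (1 - s) * ‖v‖ ^ 2 := by ring

/-- A Lipschitz map that is affine along every ray issuing from `x`. -/
theorem of_homogeneous {F : X → Y} {x : X} {L δ : ℝ} (hδ : 0 < δ)
    (hL : ∀ y z : X, ‖y - x‖ < δ → ‖z - x‖ < δ → ‖F y - F z‖ ≤ L * ‖y - z‖)
    (hF : ∀ h : X, ∀ s ∈ Set.Icc (0 : ℝ) 1, F (x + s • h) - F x = s • (F (x + h) - F x)) :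
    ChordRegularAt F x := by
  refine of_bounds (C := 0) hδ one_pos hL fun h _ s hs => ?_
  simp [hF h s hs]

theorem const (c : Y) (x : X) : ChordRegularAt (fun _ => c) x := of_contDiffAt contDiffAt_const

theorem comp_contDiffAt {G : Y → Z} {F : X → Y} {x : X} (hG : ContDiffAt ℝ 2 G (F x))
    (hF : ChordRegularAt F x) : ChordRegularAt (fun y => G (F y)) x :=
  (of_contDiffAt hG).comp hF

theorem comp_contDiffAt₂ {W : Type*} [NormedAddCommGroup W] [NormedSpace ℝ W]
    {G : Y × Z → W} {F₁ : X → Y} {F₂ : X → Z} {x : X}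
    (hG : ContDiffAt ℝ 2 G (F₁ x, F₂ x)) (h₁ : ChordRegularAt F₁ x) (h₂ : ChordRegularAt F₂ x) :
    ChordRegularAt (fun y => G (F₁ y, F₂ y)) x :=
  comp (F := fun y => (F₁ y, F₂ y)) (of_contDiffAt hG) (h₁.prodMk h₂)

theorem add {F G : X → Y} {x : X} (hF : ChordRegularAt F x) (hG : ChordRegularAt G x) :
    ChordRegularAt (fun y => F y + G y) x :=
  comp_contDiffAt₂ (G := fun q : Y × Y => q.1 + q.2) (by fun_prop) hF hG

theorem sub {F G : X → Y} {x : X} (hF : ChordRegularAt F x) (hG : ChordRegularAt G x) :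
    ChordRegularAt (fun y => F y - G y) x :=
  comp_contDiffAt₂ (G := fun q : Y × Y => q.1 - q.2) (by fun_prop) hF hG

theorem smul {F : X → ℝ} {G : X → Y} {x : X} (hF : ChordRegularAt F x) (hG : ChordRegularAt G x) :
    ChordRegularAt (fun y => F y • G y) x :=
  comp_contDiffAt₂ (G := fun q : ℝ × Y => q.1 • q.2) (by fun_prop) hF hG

theorem mul {F : X → ℝ} {G : X → ℝ} {x : X} (hF : ChordRegularAt F x) (hG : ChordRegularAt G x) :
    ChordRegularAt (fun y => F y * G y) x :=
  hF.smul hG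

theorem inv {F : X → ℝ} {x : X} (hF : ChordRegularAt F x) (h : F x ≠ 0) :
    ChordRegularAt (fun y => (F y)⁻¹) x :=
  comp_contDiffAt (contDiffAt_inv ℝ h) hF

theorem div {F : X → ℝ} {G : X → ℝ} {x : X} (hF : ChordRegularAt F x) (hG : ChordRegularAt G x)
    (h : G x ≠ 0) : ChordRegularAt (fun y => F y / G y) x := by
  simpa only [div_eq_mul_inv] using hF.mul (hG.inv h)

theorem max_zero (t : ℝ) : ChordRegularAt (fun u : ℝ => max u 0) t := by
  rcases lt_trichotomy t 0 with h | rfl | h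
  · refine (const 0 t).congr ?_
    filter_upwards [gt_mem_nhds h] with u hu using (max_eq_right hu.le).symm
  · refine of_homogeneous (L := 1) one_pos ?_ ?_
    · intro y z _ _
      simpa using abs_max_sub_max_le_max y 0 z 0
    · intro h s hs
      simp only [zero_add, max_self, sub_zero, smul_eq_mul]
      rw [mul_max_of_nonneg _ _ hs.1, mul_zero]
  · refine (of_contDiffAt contDiffAt_id).congr ?_
    filter_upwards [lt_mem_nhds h] with u hu using (max_eq_left hu.le).symm

theorem posPart {F : X → ℝ} {x : X} (hF : ChordRegularAt F x) :
    ChordRegularAt (fun y => max (F y) 0) x :=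
  (max_zero (F x)).comp hF

theorem min {F G : X → ℝ} {x : X} (hF : ChordRegularAt F x) (hG : ChordRegularAt G x) :
    ChordRegularAt (fun y => min (F y) (G y)) x := by
  -- The identity `min a b = a - max (a - b) 0`.
  refine (hF.sub (hF.sub hG).posPart).congr (Filter.Eventually.of_forall fun y => ?_)
  rcases le_total (F y) (G y) with h | h
  · simp [h]
  · simp [h]

/-- The solution of a scalar equation that is strongly monotone in the unknown. -/
theorem implicit {H : X × ℝ → ℝ} {t : X → ℝ} {x : X} {c : ℝ} (hc : 0 < c)
    (hmono : ∀ y a b, a ≤ b → c * (b - a) ≤ H (y, b) - H (y, a))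
    (hzero : ∀ y, H (y, t y) = 0) (hH : ChordRegularAt H (x, t x)) : ChordRegularAt t x := by
  -- Strong monotonicity turns every bound on a residual of `H` into a bound on the unknown.
  have key : ∀ y a b, |b - a| ≤ |H (y, b) - H (y, a)| / c := by
    intro y a b
    rw [le_div_iff₀ hc]
    rcases le_total a b with h | h
    · rw [abs_of_nonneg (sub_nonneg.2 h), mul_comm]
      exact (hmono y a b h).trans (le_abs_self _)
    · rw [abs_sub_comm, abs_of_nonneg (sub_nonneg.2 h), mul_comm, abs_sub_comm]
      exact (hmono y b a h).trans (le_abs_self _)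
  obtain ⟨A, hA, δ, hδ, hL, hch⟩ := hH
  set B := A / c with hB
  have hB0 : 0 ≤ B := by positivity
  have h0 : ∀ y, ‖y - x‖ < δ → |t y - t x| ≤ B * ‖y - x‖ := by
    intro y hy
    have h1 := hL (y, t x) (x, t x) (by simpa [Prod.norm_mk] using hy) (by simpa using hδ)
    have h2 := key y (t x) (t y)
    rw [hzero, zero_sub, abs_neg] at h2
    rw [hzero] at h1
    simp only [Real.norm_eq_abs, sub_zero, Prod.mk_sub_mk, sub_self, Prod.norm_mk, abs_zero,
      norm_nonneg, sup_of_le_left] at h1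
    refine h2.trans ?_
    rw [hB, div_mul_eq_mul_div]
    gcongr
  -- Within this radius `B * ‖y - x‖ < δ`, so `(y, t y)` stays where the bounds on `H` are valid.
  set η := δ / (B + 1) with hη
  have hη0 : 0 < η := by positivity
  have hηδ : η ≤ δ := div_le_self hδ.le (by linarith)
  have hη1 : ∀ y, ‖y - x‖ < η → |t y - t x| < δ := by
    intro y hy
    refine (h0 y (hy.trans_le hηδ)).trans_lt ?_
    rw [hη, lt_div_iff₀ (by positivity)] at hy
    nlinarith [norm_nonneg (y - x)]
  have hLip : ∀ y z, ‖y - x‖ < η → ‖z - x‖ < η → |t y - t z| ≤ B * ‖y - z‖ := by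
    intro y z hy hz
    have h1 := hL (y, t z) (z, t z)
      (by simpa [Prod.norm_mk] using ⟨hy.trans_le hηδ, hη1 z hz⟩)
      (by simpa [Prod.norm_mk] using ⟨hz.trans_le hηδ, hη1 z hz⟩)
    have h2 := key y (t z) (t y)
    rw [hzero, zero_sub, abs_neg] at h2
    rw [hzero] at h1
    simp only [Real.norm_eq_abs, sub_zero, Prod.mk_sub_mk, sub_self, Prod.norm_mk, abs_zero,
      norm_nonneg, sup_of_le_left] at h1
    refine h2.trans ?_
    rw [hB, div_mul_eq_mul_div]
    gcongr
  refine of_bounds (L := B) (C := B * (1 + B) ^ 2) hη0 hη0 hLip ?_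
  intro v hv s hs
  have hs1 := sub_nonneg.2 hs.2
  set k := t (x + v) - t x with hk
  have hkv : |k| ≤ B * ‖v‖ := by simpa using h0 (x + v) (by simpa using hv.trans_le hηδ)
  have hkδ : |k| < δ := hη1 (x + v) (by simpa using hv)
  -- Both ends of this segment are zeros of `H`, so the chord bound is a bound on `H` itself at the
  -- intermediate point.
  have h1 := hch (v, k) (by simpa [Prod.norm_mk] using ⟨hv.trans_le hηδ, hkδ⟩) s hs
  have e1 : (x, t x) + (v, k) = (x + v, t (x + v)) := by simp [hk]
  have e2 : (x, t x) + s • (v, k) = (x + s • v, t x + s * k) := by simp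
  rw [e1, e2, hzero, hzero] at h1
  have h2 := key (x + s • v) (t x + s * k) (t (x + s • v))
  rw [hzero, zero_sub, abs_neg] at h2
  simp only [sub_zero, smul_zero, Real.norm_eq_abs] at h1
  have h3 : ‖(v, k)‖ ≤ (1 + B) * ‖v‖ := by
    rw [Prod.norm_mk]
    refine max_le ?_ (hkv.trans ?_) <;> nlinarith [norm_nonneg v]
  calc ‖t (x + s • v) - t x - s • k‖ = |t (x + s • v) - (t x + s * k)| := by
        rw [Real.norm_eq_abs, smul_eq_mul, sub_sub]
    _ ≤ A * (1 - s) * ‖(v, k)‖ ^ 2 / c := h2.trans (by gcongr)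
    _ ≤ A * (1 - s) * ((1 + B) * ‖v‖) ^ 2 / c := by gcongr
    _ = B * (1 + B) ^ 2 * (1 - s) * ‖v‖ ^ 2 := by rw [hB]; ring

/-- The difference quotient `D` is Lipschitz on a right neighborhood of `0`, hence Cauchy as `t →
0⁺`. The chord bound with `s = u / t` gives the Lipschitz estimate up to a factor `t / u`, which is
at most `2` when `u ≥ t / 2`. -/
theorem directionallyDifferentiableAt [CompleteSpace Y] {F : X → Y} {x : X}
    (hF : ChordRegularAt F x) : DirectionallyDifferentiableAt F x := by
  intro v
  obtain ⟨C, hC, δ, hδ, -, hch⟩ := hF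
  set D : ℝ → Y := fun t => t⁻¹ • (F (x + t • v) - F x) with hD
  set η := δ / (‖v‖ + 1) with hη
  have hη0 : 0 < η := by positivity
  set K := 2 * C * ‖v‖ ^ 2 with hK
  have hK0 : 0 ≤ K := by positivity
  have half : ∀ t u, 0 < t → t < η → t / 2 ≤ u → u ≤ t → ‖D u - D t‖ ≤ K * (t - u) := by
    intro t u ht htη hu hut
    have hu0 : 0 < u := by linarith
    have htv : ‖t • v‖ < δ := by
      rw [norm_smul, Real.norm_of_nonneg ht.le]
      rw [hη, lt_div_iff₀ (by positivity)] at htη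
      nlinarith
    have h1 := hch (t • v) htv (u / t) ⟨by positivity, (div_le_one ht).2 hut⟩
    rw [smul_smul, div_mul_cancel₀ _ ht.ne', norm_smul, Real.norm_of_nonneg ht.le] at h1
    have e : D u - D t = u⁻¹ • (F (x + u • v) - F x - (u / t) • (F (x + t • v) - F x)) := by
      rw [hD, smul_sub, smul_smul, ← mul_div_assoc, inv_mul_cancel₀ hu0.ne', one_div]
    rw [e, norm_smul, norm_inv, Real.norm_of_nonneg hu0.le, inv_mul_le_iff₀ hu0]
    refine h1.trans ?_
    have : C * (1 - u / t) * (t * ‖v‖) ^ 2 = C * ‖v‖ ^ 2 * (t - u) * t := by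
      field_simp
    rw [this, hK]
    have h2 : 0 ≤ C * ‖v‖ ^ 2 * (t - u) :=
      mul_nonneg (by positivity) (by linarith)
    nlinarith
  -- Repeated halving removes the restriction `t / 2 ≤ u` without loss in the constant, because the
  -- bounds `K * (t - u)` telescope.
  have all : ∀ n : ℕ, ∀ t u, 0 < t → t < η → t / 2 ^ n ≤ u → u ≤ t →
      ‖D u - D t‖ ≤ K * (t - u) := by
    intro n
    induction n with
    | zero =>
      intro t u ht htη hu hut
      exact half t u ht htη (by simp at hu; linarith) hut
    | succ n ih =>
      intro t u ht htη hu hut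
      rcases le_total (t / 2) u with h | h
      · exact half t u ht htη h hut
      · have h1 := ih (t / 2) u (by linarith) (by linarith)
          (by rw [div_div, ← pow_succ']; exact hu) h
        have h2 := half t (t / 2) ht htη le_rfl (by linarith)
        calc ‖D u - D t‖ ≤ ‖D u - D (t / 2)‖ + ‖D (t / 2) - D t‖ :=
              norm_sub_le_norm_sub_add_norm_sub _ _ _
          _ ≤ K * (t - u) := by linarith
  have lip : ∀ t u, 0 < u → u ≤ t → t < η → ‖D u - D t‖ ≤ K * (t - u) := by
    intro t u hu hut htη
    have ht : 0 < t := hu.trans_le hut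
    obtain ⟨n, hn⟩ := pow_unbounded_of_one_lt (t / u) (one_lt_two : (1 : ℝ) < 2)
    refine all n t u ht htη ?_ hut
    rw [div_le_iff₀ (by positivity)]
    rw [div_lt_iff₀ hu] at hn
    linarith
  have hcau : Cauchy (Filter.map D (nhdsWithin 0 (Set.Ioi 0))) := by
    rw [Metric.cauchy_iff]
    refine ⟨inferInstance, fun ε hε => ?_⟩
    set r := Min.min η (ε / (K + 1)) with hr
    have hr0 : 0 < r := lt_min hη0 (by positivity)
    refine ⟨D '' Set.Ioo 0 r, Filter.image_mem_map (Ioo_mem_nhdsGT hr0), ?_⟩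
    have main : ∀ t u, 0 < u → u ≤ t → t < r → ‖D u - D t‖ < ε := by
      intro t u hu hut htr
      refine (lip t u hu hut (htr.trans_le (min_le_left _ _))).trans_lt ?_
      have h2 : t < ε / (K + 1) := htr.trans_le (min_le_right _ _)
      rw [lt_div_iff₀ (by positivity)] at h2
      nlinarith
    rintro _ ⟨t, ht, rfl⟩ _ ⟨u, hu, rfl⟩
    rw [dist_eq_norm]
    rcases le_total t u with h | h
    · exact main u t ht.1 h hu.2
    · rw [norm_sub_rev]
      exact main t u hu.1 h ht.2
  obtain ⟨d, hd⟩ := CompleteSpace.complete hcau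
  exact ⟨d, hd⟩

/-- If `F` is differentiable at `x + h`, the deviation from the chord vanishes at `s = 1` and is at
most `C (1 - s) ‖h‖²`, so its derivative at `1`, namely `fderiv ℝ F (x + h) h - E`, is at most `C
‖h‖²`. The bound passes to limits by continuity, and to the convex hull because the `V` with `V h`
in a fixed ball form a convex set. -/
theorem stronglySemismoothAt [FiniteDimensional ℝ Y] {F : X → Y} {x : X}
    (hF : ChordRegularAt F x) : StronglySemismoothAt F x := by
  have := FiniteDimensional.complete ℝ Y
  refine ⟨hF.lipschitzNear, hF.directionallyDifferentiableAt, ?_⟩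
  obtain ⟨C, hC, δ, hδ, hL, hch⟩ := hF
  have hdiff : ∀ h, ‖h‖ < δ → DifferentiableAt ℝ F (x + h) →
      ‖F (x + h) - F x - fderiv ℝ F (x + h) h‖ ≤ C * ‖h‖ ^ 2 := by
    intro h hh hd
    set E := F (x + h) - F x with hE
    have hline : HasDerivAt (fun s : ℝ => F (x + s • h) - F x - s • E)
        (fderiv ℝ F (x + h) h - E) 1 := by
      have h1 : HasDerivAt (fun s : ℝ => x + s • h) h 1 := by
        simpa using ((hasDerivAt_id (1 : ℝ)).smul_const h).const_add x
      have h2 : HasFDerivAt F (fderiv ℝ F (x + h)) (x + (1 : ℝ) • h) := by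
        rw [one_smul]; exact hd.hasFDerivAt
      have h3 := (h2.comp_hasDerivAt (1 : ℝ) h1).sub_const (F x)
      have h4 := h3.sub ((hasDerivAt_id (1 : ℝ)).smul_const E)
      rw [one_smul] at h4
      exact h4
    have ht := hasDerivAt_iff_tendsto_slope.1 hline
    have ht' : Filter.Tendsto (fun s => ‖slope (fun s : ℝ => F (x + s • h) - F x - s • E) 1 s‖)
        (nhdsWithin 1 (Set.Iio 1)) (nhds ‖fderiv ℝ F (x + h) h - E‖) :=
      (ht.mono_left (nhdsWithin_mono _ fun s hs => ne_of_lt hs)).norm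
    rw [norm_sub_rev]
    refine le_of_tendsto ht' ?_
    filter_upwards [Ioo_mem_nhdsLT (zero_lt_one : (0 : ℝ) < 1)] with s hs
    have h1 := hch h hh s ⟨hs.1.le, hs.2.le⟩
    have h2 : 0 < 1 - s := by linarith [hs.2]
    rw [slope_def_module, norm_smul, norm_inv, Real.norm_eq_abs, abs_sub_comm, abs_of_pos h2,
      inv_mul_le_iff₀ h2]
    simp only [one_smul, ← hE, sub_self, sub_zero]
    exact h1.trans (le_of_eq (by ring))
  refine ⟨C, δ, hδ, fun h hh V hV => ?_⟩
  set E := F (x + h) - F x with hE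
  have hconv : Convex ℝ {V : X →L[ℝ] Y | ‖E - V h‖ ≤ C * ‖h‖ ^ 2} := by
    have : {V : X →L[ℝ] Y | ‖E - V h‖ ≤ C * ‖h‖ ^ 2} =
        (ContinuousLinearMap.apply ℝ Y h).toLinearMap ⁻¹' Metric.closedBall E (C * ‖h‖ ^ 2) := by
      ext V
      simp [dist_eq_norm, norm_sub_rev]
    rw [this]
    exact (convex_closedBall _ _).linear_preimage _
  refine convexHull_min ?_ hconv hV
  rintro V ⟨u, hu, hud, hV⟩
  have hball : Metric.ball x δ ∈ nhds (x + h) :=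
    Metric.isOpen_ball.mem_nhds (by simpa [dist_eq_norm] using hh)
  have hcont : ContinuousAt F (x + h) := by
    have : LipschitzOnWith ⟨C, hC⟩ F (Metric.ball x δ) :=
      LipschitzOnWith.of_dist_le_mul fun y hy z hz => by
        rw [dist_eq_norm, dist_eq_norm]
        exact hL y z (by simpa [dist_eq_norm] using hy) (by simpa [dist_eq_norm] using hz)
    exact this.continuousOn.continuousAt hball
  have hux : Filter.Tendsto (fun n => u n - x) Filter.atTop (nhds h) := by
    simpa using hu.sub_const x
  have lhs : Filter.Tendsto (fun n => ‖F (u n) - F x - fderiv ℝ F (u n) (u n - x)‖) Filter.atTop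
      (nhds ‖F (x + h) - F x - V h‖) :=
    (((hcont.tendsto.comp hu).sub_const _).sub
      ((isBoundedBilinearMap_apply.continuous.tendsto (V, h)).comp (hV.prodMk_nhds hux))).norm
  have rhs : Filter.Tendsto (fun n => C * ‖u n - x‖ ^ 2) Filter.atTop (nhds (C * ‖h‖ ^ 2)) :=
    (hux.norm.pow 2).const_mul C
  refine le_of_tendsto_of_tendsto lhs rhs ?_
  filter_upwards [hu.eventually hball] with n hn
  have := hdiff (u n - x) (by simpa [dist_eq_norm] using hn)
    (by rw [add_sub_cancel]; exact hud n)
  rwa [add_sub_cancel] at this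

end ChordRegularAt

end Semismooth


/-! ### Algebra of symmetric tensors: pressure, deviator and `ϱ`. -/

namespace Plasticity

open Semismooth

theorem norm_sq_eq_ddot (A : Sym3) : ‖A‖ ^ 2 = ddot A A := by
  have h : ‖A‖ = ‖A.1‖ := rfl
  rw [h, Matrix.frobenius_norm_def, ← Real.rpow_natCast, ← Real.rpow_mul (by positivity)]
  simp [ddot, ← pow_two]

theorem ddot_add_left (A B C : Sym3) : ddot (A + B) C = ddot A C + ddot B C := by
  simp only [ddot, Fin.sum_univ_three, Submodule.coe_add, Matrix.add_apply]
  ring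

theorem ddot_smul_left (a : ℝ) (A B : Sym3) : ddot (a • A) B = a * ddot A B := by
  simp only [ddot, Fin.sum_univ_three, Submodule.coe_smul, Matrix.smul_apply, smul_eq_mul]
  ring

theorem ddot_comm (A B : Sym3) : ddot A B = ddot B A := by
  simp only [ddot, mul_comm]

theorem ddot_add_right (A B C : Sym3) : ddot A (B + C) = ddot A B + ddot A C := by
  rw [ddot_comm, ddot_add_left, ddot_comm B, ddot_comm C]

theorem ddot_smul_right (a : ℝ) (A B : Sym3) : ddot A (a • B) = a * ddot A B := by
  rw [ddot_comm, ddot_smul_left, ddot_comm B]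

theorem ddot_sub_left (A B C : Sym3) : ddot (A - B) C = ddot A C - ddot B C := by
  simp only [ddot, Fin.sum_univ_three, Submodule.coe_sub, Matrix.sub_apply]
  ring

theorem ddot_sub_right (A B C : Sym3) : ddot A (B - C) = ddot A B - ddot A C := by
  rw [ddot_comm, ddot_sub_left, ddot_comm B, ddot_comm C]

theorem ddot_id_id : ddot idTensor idTensor = 3 := by
  simp [ddot, idTensor, Matrix.one_apply]

theorem ddot_le_norm_mul_norm (A B : Sym3) : ddot A B ≤ ‖A‖ * ‖B‖ := by
  refine (abs_le_of_sq_le_sq' ?_ (by positivity)).2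
  rw [mul_pow, norm_sq_eq_ddot, norm_sq_eq_ddot]
  have := Finset.sum_mul_sq_le_sq_mul_sq (Finset.univ : Finset (Fin 3 × Fin 3))
    (fun i => A.1 i.1 i.2) (fun i => B.1 i.1 i.2)
  simpa [ddot, Fintype.sum_prod_type, pow_two] using this

/-- The pressure as a continuous linear form. -/
def pressureCLM : Sym3 →L[ℝ] ℝ :=
  LinearMap.toContinuousLinearMap
    { toFun := pressure
      map_add' := fun A B => by simp only [pressure, ddot_add_right]; ring
      map_smul' := fun a A => by
        simp only [pressure, ddot_smul_right, RingHom.id_apply, smul_eq_mul]; ring }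

@[simp] theorem pressureCLM_apply (σ : Sym3) : pressureCLM σ = pressure σ := rfl

theorem pressure_add (A B : Sym3) : pressure (A + B) = pressure A + pressure B :=
  map_add pressureCLM A B

theorem pressure_sub (A B : Sym3) : pressure (A - B) = pressure A - pressure B :=
  map_sub pressureCLM A B

theorem pressure_smul (a : ℝ) (A : Sym3) : pressure (a • A) = a * pressure A :=
  map_smul pressureCLM a A

theorem pressure_id : pressure idTensor = 1 := by
  rw [pressure, ddot_id_id]; norm_num

/-- The deviator as a continuous linear map. -/
def deviatorCLM : Sym3 →L[ℝ] Sym3 := .id ℝ Sym3 - pressureCLM.smulRight idTensor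

@[simp] theorem deviatorCLM_apply (σ : Sym3) : deviatorCLM σ = deviator σ := rfl

theorem deviator_add (A B : Sym3) : deviator (A + B) = deviator A + deviator B :=
  map_add deviatorCLM A B

theorem deviator_sub (A B : Sym3) : deviator (A - B) = deviator A - deviator B :=
  map_sub deviatorCLM A B

theorem deviator_smul (a : ℝ) (A : Sym3) : deviator (a • A) = a • deviator A :=
  map_smul deviatorCLM a A

theorem deviator_id : deviator idTensor = 0 := by
  rw [deviator, pressure_id, one_smul, sub_self]

theorem pressure_deviator (σ : Sym3) : pressure (deviator σ) = 0 := by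
  rw [deviator, pressure_sub, pressure_smul, pressure_id]; ring

theorem deviator_deviator (σ : Sym3) : deviator (deviator σ) = deviator σ := by
  rw [deviator, pressure_deviator, zero_smul, sub_zero]

theorem pressure_smul_add_deviator (σ : Sym3) : pressure σ • idTensor + deviator σ = σ := by
  rw [deviator]; abel

theorem ext_pressure_deviator {σ τ : Sym3} (hp : pressure σ = pressure τ)
    (hd : deviator σ = deviator τ) : σ = τ := by
  rw [← pressure_smul_add_deviator σ, ← pressure_smul_add_deviator τ, hp, hd]

theorem ddot_id (σ : Sym3) : ddot idTensor σ = 3 * pressure σ := by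
  rw [pressure]; ring

theorem ddot_deviator_right (n σ : Sym3) (hn : pressure n = 0) :
    ddot n (deviator σ) = ddot n σ := by
  rw [deviator, ddot_sub_right, ddot_smul_right, ddot_comm n idTensor, ddot_id, hn]; ring

theorem norm_deviator_le (σ : Sym3) : ‖deviator σ‖ ≤ ‖σ‖ := by
  refine (abs_le_of_sq_le_sq' ?_ (norm_nonneg _)).2
  have h1 : ddot (deviator σ) (deviator σ) = ddot σ (deviator σ) := by
    rw [ddot_deviator_right _ _ (pressure_deviator σ), ddot_comm]
  have h2 : ddot σ (deviator σ) = ddot σ σ - 3 * pressure σ ^ 2 := by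
    rw [deviator, ddot_sub_right, ddot_smul_right, ddot_comm σ idTensor, ddot_id]; ring
  rw [norm_sq_eq_ddot, norm_sq_eq_ddot, h1, h2]
  nlinarith [sq_nonneg (pressure σ)]

theorem rho_nonneg (σ : Sym3) : 0 ≤ rho σ := norm_nonneg _

theorem rho_eq_zero {σ : Sym3} : rho σ = 0 ↔ deviator σ = 0 := norm_eq_zero

theorem rho_le_norm (σ : Sym3) : rho σ ≤ ‖σ‖ := norm_deviator_le σ

theorem rho_sq (σ : Sym3) : rho σ ^ 2 = ddot (deviator σ) (deviator σ) := norm_sq_eq_ddot _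

theorem rho_smul (a : ℝ) (σ : Sym3) : rho (a • σ) = |a| * rho σ := by
  rw [rho, deviator_smul, norm_smul, Real.norm_eq_abs, rho]

theorem rho_eq_mul {a : ℝ} (ha : 0 ≤ a) {σ τ : Sym3} (h : deviator σ = a • deviator τ) :
    rho σ = a * rho τ := by
  rw [rho, h, norm_smul, Real.norm_of_nonneg ha, rho]

theorem rho_add_le (σ τ : Sym3) : rho (σ + τ) ≤ rho σ + rho τ := by
  rw [rho, deviator_add]; exact norm_add_le _ _

theorem abs_rho_sub_le (σ τ : Sym3) : |rho σ - rho τ| ≤ ‖σ - τ‖ := by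
  refine (abs_norm_sub_norm_le _ _).trans ?_
  rw [← deviator_sub]
  exact norm_deviator_le _

theorem contDiffAt_rho {σ : Sym3} (h : rho σ ≠ 0) : ContDiffAt ℝ 2 rho σ := by
  have e : rho = fun τ => √(ddot (deviatorCLM τ) (deviatorCLM τ)) := by
    funext τ
    rw [deviatorCLM_apply, ← rho_sq, Real.sqrt_sq (rho_nonneg τ)]
  have hentry : ∀ i j, ContDiff ℝ 2 fun A : Sym3 => A.1 i j := fun i j =>
    (LinearMap.toContinuousLinearMap
      ((Matrix.entryLinearMap ℝ ℝ i j).comp symSubmodule.subtype)).contDiff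
  have hd : ContDiff ℝ 2 fun A : Sym3 => ddot A A := by
    unfold ddot
    exact ContDiff.sum fun i _ => ContDiff.sum fun j _ => (hentry i j).mul (hentry i j)
  rw [e]
  refine ContDiffAt.sqrt (hd.comp deviatorCLM.contDiff).contDiffAt ?_
  rw [deviatorCLM_apply, ← rho_sq]
  exact pow_ne_zero 2 h

theorem chordRegularAt_rho (σ : Sym3) : ChordRegularAt rho σ := by
  by_cases h : rho σ = 0
  · refine ChordRegularAt.of_homogeneous (L := 1) one_pos ?_ ?_
    · intro y z _ _
      rw [one_mul]
      exact abs_rho_sub_le y z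
    · intro v s hs
      have hd := rho_eq_zero.1 h
      have h1 : rho (σ + s • v) = s * rho (σ + v) := by
        refine rho_eq_mul hs.1 ?_
        rw [deviator_add, deviator_add, deviator_smul, hd, zero_add, zero_add]
      rw [h1, h, sub_zero, sub_zero, smul_eq_mul]
  · exact ChordRegularAt.of_contDiffAt (contDiffAt_rho h)

/-! ### The largest eigenvalue of a symmetric tensor. -/

section Eigenvalue

open Matrix

theorem exists_orthogonal_diagonalization (A : Matrix (Fin 3) (Fin 3) ℝ) (hA : A.IsSymm) :
    ∃ (U : Matrix (Fin 3) (Fin 3) ℝ) (d : Fin 3 → ℝ),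
      Uᵀ * U = 1 ∧ U * Uᵀ = 1 ∧ A = U * diagonal d * Uᵀ := by
  have h : A.IsHermitian := by
    rw [Matrix.IsHermitian, conjTranspose_eq_transpose_of_trivial]; exact hA
  have hs : (star (h.eigenvectorUnitary : Matrix (Fin 3) (Fin 3) ℝ)) =
      (h.eigenvectorUnitary : Matrix (Fin 3) (Fin 3) ℝ)ᵀ := by
    rw [star_eq_conjTranspose, conjTranspose_eq_transpose_of_trivial]
  refine ⟨h.eigenvectorUnitary, h.eigenvalues, ?_, ?_, ?_⟩
  · rw [← hs]; exact Unitary.coe_star_mul_self _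
  · rw [← hs]; exact Unitary.coe_mul_star_self _
  · have := h.spectral_theorem
    rw [Unitary.conjStarAlgAut_apply, hs] at this
    exact this

/-- All claims are read off in an orthonormal eigenbasis. The third is a spectral gap inequality: it
bounds the Rayleigh deficit of any vector by its squared eigenvector residual. The power traces feed
the formula for the Lode angle. -/
theorem exists_top_eigenvalue (A : Sym3) :
    ∃ μ : ℝ, (∃ v : Fin 3 → ℝ, v ⬝ᵥ v = 1 ∧ A.1 *ᵥ v = μ • v) ∧
      (∀ v : Fin 3 → ℝ, v ⬝ᵥ (A.1 *ᵥ v) ≤ μ * (v ⬝ᵥ v)) ∧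
      (∃ g > 0, ∀ v : Fin 3 → ℝ,
        g * (μ * (v ⬝ᵥ v) - v ⬝ᵥ (A.1 *ᵥ v)) ≤ (A.1 *ᵥ v - μ • v) ⬝ᵥ (A.1 *ᵥ v - μ • v)) ∧
      ∃ b c : ℝ, b ≤ μ ∧ c ≤ μ ∧ A.1.trace = μ + b + c ∧
        (A.1 ^ 2).trace = μ ^ 2 + b ^ 2 + c ^ 2 ∧ (A.1 ^ 3).trace = μ ^ 3 + b ^ 3 + c ^ 3 := by
  obtain ⟨U, d, hU1, hU2, hA⟩ := exists_orthogonal_diagonalization A.1 A.2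
  obtain ⟨i, hi⟩ := Finite.exists_max d
  have hdot : ∀ x y : Fin 3 → ℝ, (U *ᵥ x) ⬝ᵥ (U *ᵥ y) = x ⬝ᵥ y := by
    intro x y
    rw [dotProduct_mulVec, vecMul_mulVec, hU1, vecMul_one]
  have hv : ∀ v : Fin 3 → ℝ, ∃ w, v = U *ᵥ w := fun v =>
    ⟨Uᵀ *ᵥ v, by rw [mulVec_mulVec, hU2, one_mulVec]⟩
  have hAU : ∀ w : Fin 3 → ℝ, A.1 *ᵥ (U *ᵥ w) = U *ᵥ (fun j => d j * w j) := by
    intro w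
    have : diagonal d *ᵥ w = fun j => d j * w j := by ext j; exact mulVec_diagonal d w j
    rw [hA, mulVec_mulVec, mul_assoc, mul_assoc, hU1, mul_one, ← mulVec_mulVec, this]
  have htr : ∀ k : ℕ, (A.1 ^ k).trace = ∑ j, d j ^ k := by
    intro k
    have : A.1 ^ k = U * diagonal (d ^ k) * Uᵀ := by
      induction k with
      | zero => simp [hU2]
      | succ k ih =>
        calc A.1 ^ (k + 1) = (U * diagonal (d ^ k) * Uᵀ) * (U * diagonal d * Uᵀ) := by
              rw [pow_succ, ih, ← hA]
          _ = U * (diagonal (d ^ k) * (Uᵀ * U) * diagonal d) * Uᵀ := by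
              simp only [mul_assoc]
          _ = U * diagonal (d ^ (k + 1)) * Uᵀ := by
              rw [hU1, mul_one, diagonal_mul_diagonal]
              rfl
    rw [this, trace_mul_comm, ← mul_assoc, hU1, one_mul, trace_diagonal]
    rfl
  refine ⟨d i, ⟨U *ᵥ Pi.single i 1, ?_, ?_⟩, ?_, ?_, ?_⟩
  · rw [hdot]; simp
  · rw [hAU, ← mulVec_smul]
    congr 1
    ext j
    by_cases h : j = i
    · subst h; simp
    · simp [h]
  · intro v
    obtain ⟨w, rfl⟩ := hv v
    rw [hAU, hdot, hdot, dotProduct, dotProduct, Finset.mul_sum]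
    refine Finset.sum_le_sum fun j _ => ?_
    nlinarith [mul_nonneg (sub_nonneg.2 (hi j)) (mul_self_nonneg (w j))]
  -- The constant `g` is the least of these values. The dummy value `1` at indices sharing the top
  -- eigenvalue keeps it positive; there both sides of the inequality vanish.
  · set f : Fin 3 → ℝ := fun j => if d j < d i then d i - d j else 1 with hf
    obtain ⟨k, hk⟩ := Finite.exists_min f
    have hpos : ∀ j, 0 < f j := fun j => by
      simp only [hf]; split_ifs with h
      · linarith
      · exact one_pos
    refine ⟨f k, hpos k, fun v => ?_⟩
    obtain ⟨w, rfl⟩ := hv v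
    rw [hAU, ← mulVec_smul, ← mulVec_sub, hdot, hdot, hdot, dotProduct, dotProduct, dotProduct,
      Finset.mul_sum, ← Finset.sum_sub_distrib, Finset.mul_sum]
    refine Finset.sum_le_sum fun j _ => ?_
    have h1 : f k * (d i - d j) ≤ (d i - d j) ^ 2 := by
      rcases (hi j).lt_or_eq with h | h
      · have := hk j
        simp only [hf, h, if_true] at this ⊢
        nlinarith
      · rw [h]; simp
    have h2 := mul_le_mul_of_nonneg_right h1 (mul_self_nonneg (w j))
    simp only [Pi.sub_apply, Pi.smul_apply, smul_eq_mul]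
    calc _ = f k * (d i - d j) * (w j * w j) := by ring
      _ ≤ _ := h2
      _ = _ := by ring
  · have h1 := htr 1
    rw [pow_one] at h1
    rw [h1, htr 2, htr 3]
    simp only [Fin.sum_univ_three, pow_one]
    have h0 := hi 0
    have h1 := hi 1
    have h2 := hi 2
    fin_cases i
    · exact ⟨d 1, d 2, h1, h2, rfl, rfl, rfl⟩
    · exact ⟨d 0, d 2, h0, h2, by simp; ring, by simp; ring, by simp; ring⟩
    · exact ⟨d 0, d 1, h0, h1, by simp; ring, by simp; ring, by simp; ring⟩

/-- The largest eigenvalue of a symmetric tensor. -/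
def topEig (A : Sym3) : ℝ := (exists_top_eigenvalue A).choose

theorem topEig_spec (A : Sym3) :
    (∃ v : Fin 3 → ℝ, v ⬝ᵥ v = 1 ∧ A.1 *ᵥ v = topEig A • v) ∧
      (∀ v : Fin 3 → ℝ, v ⬝ᵥ (A.1 *ᵥ v) ≤ topEig A * (v ⬝ᵥ v)) ∧
      (∃ g > 0, ∀ v : Fin 3 → ℝ,
        g * (topEig A * (v ⬝ᵥ v) - v ⬝ᵥ (A.1 *ᵥ v)) ≤
          (A.1 *ᵥ v - topEig A • v) ⬝ᵥ (A.1 *ᵥ v - topEig A • v)) ∧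
      ∃ b c : ℝ, b ≤ topEig A ∧ c ≤ topEig A ∧ A.1.trace = topEig A + b + c ∧
        (A.1 ^ 2).trace = topEig A ^ 2 + b ^ 2 + c ^ 2 ∧
        (A.1 ^ 3).trace = topEig A ^ 3 + b ^ 3 + c ^ 3 :=
  (exists_top_eigenvalue A).choose_spec

theorem dotProduct_mulVec_self_le (A : Sym3) (v : Fin 3 → ℝ) :
    (A.1 *ᵥ v) ⬝ᵥ (A.1 *ᵥ v) ≤ ‖A‖ ^ 2 * (v ⬝ᵥ v) := by
  rw [norm_sq_eq_ddot, ddot, Finset.sum_mul]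
  refine Finset.sum_le_sum fun i _ => ?_
  have := Finset.sum_mul_sq_le_sq_mul_sq Finset.univ (fun j => A.1 i j) v
  simpa [mulVec, dotProduct, pow_two] using this

theorem dotProduct_mulVec_le (A : Sym3) {v : Fin 3 → ℝ} (hv : v ⬝ᵥ v = 1) :
    v ⬝ᵥ (A.1 *ᵥ v) ≤ ‖A‖ := by
  refine (abs_le_of_sq_le_sq' ?_ (norm_nonneg _)).2
  have h1 := Finset.sum_mul_sq_le_sq_mul_sq Finset.univ v (A.1 *ᵥ v)
  have h2 := dotProduct_mulVec_self_le A v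
  have e : ∀ u : Fin 3 → ℝ, ∑ i, u i ^ 2 = u ⬝ᵥ u := fun u => by simp [dotProduct, pow_two]
  rw [e, e, hv, one_mul] at h1
  rw [hv, mul_one] at h2
  exact h1.trans h2

theorem topEig_sub_le (A B : Sym3) : topEig A - topEig B ≤ ‖A - B‖ := by
  obtain ⟨v, hv, hAv⟩ := (topEig_spec A).1
  have h1 := (topEig_spec B).2.1 v
  have h2 := dotProduct_mulVec_le (A - B) hv
  have e : v ⬝ᵥ (A.1 *ᵥ v) = topEig A := by rw [hAv, dotProduct_smul, hv]; simp
  rw [Submodule.coe_sub, sub_mulVec, dotProduct_sub, e] at h2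
  rw [hv] at h1
  linarith

theorem abs_topEig_sub_le (A B : Sym3) : |topEig A - topEig B| ≤ ‖A - B‖ := by
  refine abs_sub_le_iff.2 ⟨topEig_sub_le A B, ?_⟩
  rw [norm_sub_rev]
  exact topEig_sub_le B A

/-- The largest eigenvalue is convex, so it lies below its chord. For the other side, a unit top
eigenvector `v` of `A + H` is a test vector for `A + s • H`; the loss is `1 - s` times the Rayleigh
deficit of `v` for `A`. By the gap inequality this deficit is at most `1 / g` times the squared
residual of `v`, and the residual is at most `2 ‖H‖`. No simplicity of the eigenvalue is needed. -/
theorem chordRegularAt_topEig (A : Sym3) : ChordRegularAt topEig A := by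
  obtain ⟨g, hg, hgap⟩ := (topEig_spec A).2.2.1
  refine ChordRegularAt.of_bounds (L := 1) (C := 4 / g) one_pos one_pos ?_ ?_
  · intro y z _ _
    rw [one_mul]
    exact abs_topEig_sub_le y z
  · intro H _ s hs
    have hs1 := sub_nonneg.2 hs.2
    set B := A + H with hB
    have quad : ∀ v : Fin 3 → ℝ, v ⬝ᵥ ((A + s • H).1 *ᵥ v) =
        (1 - s) * (v ⬝ᵥ (A.1 *ᵥ v)) + s * (v ⬝ᵥ (B.1 *ᵥ v)) := by
      intro v
      simp only [hB, Submodule.coe_add, Submodule.coe_smul, add_mulVec, smul_mulVec,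
        dotProduct_add, dotProduct_smul, smul_eq_mul]
      ring
    rw [Real.norm_eq_abs, smul_eq_mul, abs_le]
    constructor
    · obtain ⟨v, hv, hBv⟩ := (topEig_spec B).1
      have h1 := (topEig_spec (A + s • H)).2.1 v
      have h2 := hgap v
      have e : v ⬝ᵥ (B.1 *ᵥ v) = topEig B := by rw [hBv, dotProduct_smul, hv]; simp
      rw [quad, hv, e, mul_one] at h1
      have e2 : A.1 *ᵥ v - topEig A • v = (topEig B - topEig A) • v - H.1 *ᵥ v := by
        have : A.1 *ᵥ v = B.1 *ᵥ v - H.1 *ᵥ v := by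
          simp [hB, add_mulVec]
        rw [this, hBv]
        module
      have h3 : (A.1 *ᵥ v - topEig A • v) ⬝ᵥ (A.1 *ᵥ v - topEig A • v) ≤ 4 * ‖H‖ ^ 2 := by
        have h4 := dotProduct_mulVec_self_le H v
        have h5 := sq_le_sq' (neg_le_of_abs_le (abs_topEig_sub_le B A))
          (le_of_abs_le (abs_topEig_sub_le B A))
        have h6 : B - A = H := by rw [hB]; abel
        rw [h6] at h5
        have h7 : 0 ≤ ((topEig B - topEig A) • v + H.1 *ᵥ v) ⬝ᵥ
            ((topEig B - topEig A) • v + H.1 *ᵥ v) := by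
          simpa [dotProduct] using Finset.sum_nonneg fun i _ =>
            mul_self_nonneg (((topEig B - topEig A) • v + H.1 *ᵥ v) i)
        rw [hv, mul_one] at h4
        rw [e2]
        simp only [dotProduct_add, add_dotProduct, dotProduct_sub, sub_dotProduct,
          dotProduct_smul, smul_dotProduct, smul_eq_mul, hv] at h7 ⊢
        nlinarith
      rw [hv, mul_one] at h2
      have h4 : topEig A - v ⬝ᵥ (A.1 *ᵥ v) ≤ 4 / g * ‖H‖ ^ 2 := by
        rw [div_mul_eq_mul_div, le_div_iff₀ hg, mul_comm]
        exact h2.trans h3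
      have h5 := mul_le_mul_of_nonneg_left h4 hs1
      nlinarith
    · obtain ⟨v, hv, hAv⟩ := (topEig_spec (A + s • H)).1
      have e : v ⬝ᵥ ((A + s • H).1 *ᵥ v) = topEig (A + s • H) := by
        rw [hAv, dotProduct_smul, hv]; simp
      have h1 := (topEig_spec A).2.1 v
      have h2 := (topEig_spec B).2.1 v
      rw [quad] at e
      rw [hv, mul_one] at h1 h2
      have h3 : 0 ≤ 4 / g * (1 - s) * ‖H‖ ^ 2 := by positivity
      nlinarith [mul_le_mul_of_nonneg_left h1 hs1, mul_le_mul_of_nonneg_left h2 hs.1]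

end Eigenvalue


/-! ### The Lode angle and the invariant `ϱ_e`. -/

theorem cos_lodeAngle_mem (σ : Sym3) : Real.cos (lodeAngle σ) ∈ Set.Icc (1 / 2 : ℝ) 1 := by
  refine ⟨?_, Real.cos_le_one _⟩
  rw [← Real.cos_pi_div_three]
  have h0 := Real.arccos_nonneg (3 * √3 / 2 * (J3 σ / J2 σ ^ (3 / 2 : ℝ)))
  have h1 := Real.arccos_le_pi (3 * √3 / 2 * (J3 σ / J2 σ ^ (3 / 2 : ℝ)))
  have h2 := Real.pi_pos
  exact Real.cos_le_cos_of_nonneg_of_le_pi (by unfold lodeAngle; positivity) (by linarith)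
    (by unfold lodeAngle; linarith)

/-- The product `ϱ cos θ`, expressed through the largest eigenvalue of the deviator. -/
def rhoCos (σ : Sym3) : ℝ := √(3 / 2) * topEig (deviator σ)

/-- This is the trigonometric solution of the depressed cubic. The eigenvalues of the deviator sum
to zero, so `x = √(3/2) a / ϱ` satisfies `4x³ - 3x = cos 3θ`. -/
theorem cos_lodeAngle {σ : Sym3} (h : rho σ ≠ 0) : Real.cos (lodeAngle σ) = rhoCos σ / rho σ := by
  have hρ : 0 < rho σ := (rho_nonneg σ).lt_of_ne' h
  obtain ⟨b, c, hb, hc, h1, h2, h3⟩ := (topEig_spec (deviator σ)).2.2.2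
  set a := topEig (deviator σ) with ha
  have htr : (deviator σ).1.trace = 0 := by
    have h0 := pressure_deviator σ
    have h4 : (deviator σ).1.trace = ddot idTensor (deviator σ) := by
      simp [ddot, idTensor, Matrix.trace, Matrix.one_apply]
    rw [h4, ddot_id, h0, mul_zero]
  have hsq : ((deviator σ).1 ^ 2).trace = rho σ ^ 2 := by
    rw [rho_sq, pow_two]
    simp only [ddot, Matrix.trace, Matrix.diag, Matrix.mul_apply]
    refine Finset.sum_congr rfl fun i _ => Finset.sum_congr rfl fun j _ => ?_
    congr 1
    exact (deviator σ).2.apply i j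
  have hJ3 : (a ^ 3 + b ^ 3 + c ^ 3) / 3 = J3 σ := by rw [J3, h3]
  have hJ2 : J2 σ = rho σ ^ 2 / 2 := by rw [J2, rho_sq]
  rw [htr] at h1
  rw [hsq] at h2
  obtain rfl : c = -a - b := by linarith
  have hs2 : √(3 / 2 : ℝ) ^ 2 = 3 / 2 := Real.sq_sqrt (by norm_num)
  have hs0 : 0 < √(3 / 2 : ℝ) := Real.sqrt_pos.2 (by norm_num)
  have ha0 : 0 ≤ a := by linarith
  set x := √(3 / 2 : ℝ) * a / rho σ with hx
  have hx0 : 0 ≤ x := by positivity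
  have hxρ : x * rho σ = √(3 / 2) * a := by rw [hx, div_mul_cancel₀ _ h]
  have hxsq : x ^ 2 * rho σ ^ 2 = 3 / 2 * a ^ 2 := by
    rw [← mul_pow, hxρ, mul_pow, hs2]
  have hx1 : x ≤ 1 := by
    rw [hx, div_le_one hρ]
    refine (abs_le_of_sq_le_sq' ?_ hρ.le).2
    rw [mul_pow, hs2, h2]
    nlinarith [sq_nonneg (a + 2 * b)]
  -- Equivalent to `(a - b)(a - c) ≥ 0`, so this is where `a` must be the top eigenvalue. It places
  -- `3 arccos x` in `[0, π]`, where `arccos` inverts `cos`.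
  have hx2 : 1 / 2 ≤ x := by
    rw [hx, le_div_iff₀ hρ]
    refine (abs_le_of_sq_le_sq' ?_ (by positivity)).2
    rw [mul_pow, mul_pow, hs2, h2]
    nlinarith [mul_nonneg (sub_nonneg.2 hb) (sub_nonneg.2 hc)]
  have hφ0 := Real.arccos_nonneg x
  have hφ1 : Real.arccos x ≤ Real.pi / 3 := by
    rw [← Real.arccos_cos (x := Real.pi / 3) (by positivity) (by linarith [Real.pi_pos]),
      Real.cos_pi_div_three]
    exact Real.arccos_le_arccos hx2
  have hcos : Real.cos (Real.arccos x) = x := Real.cos_arccos (by linarith) hx1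
  have hpow : J2 σ ^ (3 / 2 : ℝ) = (rho σ / √2) ^ 3 := by
    have e : J2 σ = (rho σ / √2) ^ 2 := by
      rw [hJ2, div_pow, Real.sq_sqrt (by norm_num)]
    rw [e, ← Real.rpow_natCast, ← Real.rpow_natCast, ← Real.rpow_mul (by positivity)]
    norm_num
  have harg : 3 * √3 / 2 * (J3 σ / J2 σ ^ (3 / 2 : ℝ)) = Real.cos (3 * Real.arccos x) := by
    rw [Real.cos_three_mul, hcos, hpow, ← hJ3]
    have e2 : √2 ^ 2 = (2 : ℝ) := Real.sq_sqrt (by norm_num)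
    have e3 : √(3 / 2 : ℝ) = √3 / √2 := Real.sqrt_div (by norm_num) _
    have e4 : √3 ^ 2 = (3 : ℝ) := Real.sq_sqrt (by norm_num)
    have hq : √2 ≠ 0 := by positivity
    have e5 : 4 * x ^ 3 - 3 * x =
        √(3 / 2) * a * (6 * a ^ 2 - 3 * rho σ ^ 2) / rho σ ^ 3 := by
      rw [eq_div_iff (pow_ne_zero 3 h)]
      calc (4 * x ^ 3 - 3 * x) * rho σ ^ 3
          = x * rho σ * (4 * (x ^ 2 * rho σ ^ 2) - 3 * rho σ ^ 2) := by ring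
        _ = _ := by rw [hxρ, hxsq]; ring
    rw [e5, e3, h2, div_pow]
    have e6 : √2 ^ 3 = 2 * √2 := by rw [pow_succ, e2]
    rw [e6]
    field_simp
    rw [e2]
    ring
  rw [lodeAngle, harg, Real.arccos_cos (by positivity) (by linarith),
    mul_div_cancel_left₀ _ (by norm_num : (3 : ℝ) ≠ 0), hcos, rhoCos]

theorem rhoExc_eq (e : ℝ) (σ : Sym3) : rhoExc e σ = rho σ * rExc e (rhoCos σ / rho σ) := by
  by_cases h : rho σ = 0
  · rw [rhoExc, h, zero_mul, zero_mul]
  · rw [rhoExc, cos_lodeAngle h]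

theorem rhoCos_div_rho_mem {σ : Sym3} (h : rho σ ≠ 0) :
    rhoCos σ / rho σ ∈ Set.Icc (1 / 2 : ℝ) 1 :=
  cos_lodeAngle h ▸ cos_lodeAngle_mem σ

theorem rExc_half {c : ℝ} (hc : 0 < c) : rExc (1 / 2) c = 2 * c := by
  rw [rExc]
  have h : 2 * (1 / 2 : ℝ) - 1 = 0 := by norm_num
  rw [h]
  field_simp
  ring

theorem rExc_radicand_pos {e c : ℝ} (he : 1 / 2 < e) (he1 : e ≤ 1) (hc : 1 / 2 ≤ c) :
    0 < 4 * (1 - e ^ 2) * c ^ 2 + 5 * e ^ 2 - 4 * e := by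
  have h1 : 0 ≤ 1 - e ^ 2 := by nlinarith
  nlinarith [mul_nonneg h1 (by nlinarith : (0 : ℝ) ≤ 4 * c ^ 2 - 1),
    sq_pos_of_pos (by linarith : 0 < 2 * e - 1)]

theorem rExc_denom_pos {e c : ℝ} (he : 1 / 2 < e) (he1 : e ≤ 1) (hc : 1 / 2 ≤ c) :
    0 < 2 * (1 - e ^ 2) * c + (2 * e - 1) * √(4 * (1 - e ^ 2) * c ^ 2 + 5 * e ^ 2 - 4 * e) := by
  have h1 : 0 ≤ 1 - e ^ 2 := by nlinarith
  have h2 := Real.sqrt_pos.2 (rExc_radicand_pos he he1 hc)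
  have h3 : 0 < 2 * e - 1 := by linarith
  positivity

theorem rExc_nonneg {e c : ℝ} (he : 1 / 2 ≤ e) (he1 : e ≤ 1) (hc : 1 / 2 ≤ c) :
    0 ≤ rExc e c := by
  have h1 : 0 ≤ 1 - e ^ 2 := by nlinarith
  have h3 : 0 ≤ 2 * e - 1 := by linarith
  unfold rExc
  positivity

/-- For `e > 1/2` the radicand is at least `(2e - 1)²`. For `e = 1/2` it vanishes at `c = 1/2`, but
the root then has coefficient zero and the function is `2c` near the point. -/
theorem contDiffAt_rExc {e c : ℝ} (he : 1 / 2 ≤ e) (he1 : e ≤ 1) (hc : 1 / 2 ≤ c) :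
    ContDiffAt ℝ 2 (rExc e) c := by
  rcases he.eq_or_lt with rfl | he
  · have h2 : ContDiffAt ℝ 2 (fun c : ℝ => 2 * c) c := by fun_prop
    refine h2.congr_of_eventuallyEq ?_
    filter_upwards [lt_mem_nhds (by linarith : 0 < c)] with u hu using rExc_half hu
  · have hs : ContDiffAt ℝ 2 (fun c : ℝ => √(4 * (1 - e ^ 2) * c ^ 2 + 5 * e ^ 2 - 4 * e)) c :=
      ContDiffAt.sqrt (by fun_prop) (rExc_radicand_pos he he1 hc).ne'
    unfold rExc
    exact ContDiffAt.div (by fun_prop) (by fun_prop) (rExc_denom_pos he he1 hc).ne'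

theorem exists_lipschitz_rExc {e : ℝ} (he : 1 / 2 ≤ e) (he1 : e ≤ 1) :
    ∃ L : ℝ, 0 ≤ L ∧ (∀ c ∈ Set.Icc (1 / 2 : ℝ) 1, rExc e c ≤ L) ∧
      ∀ c ∈ Set.Icc (1 / 2 : ℝ) 1, ∀ d ∈ Set.Icc (1 / 2 : ℝ) 1,
        |rExc e c - rExc e d| ≤ L * |c - d| := by
  have hd : ∀ c ∈ Set.Icc (1 / 2 : ℝ) 1, ContDiffAt ℝ 2 (rExc e) c := fun c hc =>
    contDiffAt_rExc he he1 hc.1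
  have hcont : ContinuousOn (rExc e) (Set.Icc (1 / 2 : ℝ) 1) := fun c hc =>
    (hd c hc).continuousAt.continuousWithinAt
  have hcont' : ContinuousOn (deriv (rExc e)) (Set.Icc (1 / 2 : ℝ) 1) := fun c hc =>
    (((hd c hc).fderiv_right (m := 1) (by norm_num)).continuousAt.clm_apply
      continuousAt_const).continuousWithinAt
  obtain ⟨A, hA⟩ := isCompact_Icc.exists_bound_of_continuousOn hcont
  obtain ⟨B, hB⟩ := isCompact_Icc.exists_bound_of_continuousOn hcont'
  refine ⟨max 0 (max A B), le_max_left _ _, fun c hc => ?_, fun c hc d hd' => ?_⟩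
  · exact (le_abs_self _).trans ((hA c hc).trans ((le_max_left _ _).trans (le_max_right _ _)))
  · refine ((convex_Icc _ _).norm_image_sub_le_of_norm_deriv_le (𝕜 := ℝ) (f := rExc e) (C := B)
      (fun x hx => (hd x hx).differentiableAt (by norm_num)) hB hd' hc).trans ?_
    rw [Real.norm_eq_abs]
    gcongr
    exact (le_max_right _ _).trans (le_max_right _ _)

theorem rhoExc_nonneg {e : ℝ} (he : 1 / 2 ≤ e) (he1 : e ≤ 1) (σ : Sym3) : 0 ≤ rhoExc e σ :=
  mul_nonneg (rho_nonneg σ) (rExc_nonneg he he1 (cos_lodeAngle_mem σ).1)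

/-- The quotient `J₃ / J₂^(3/2)` is invariant under positive scaling of the deviator, hence so is
the Lode angle. -/
theorem rhoExc_eq_mul {a : ℝ} (ha : 0 ≤ a) {e : ℝ} {σ τ : Sym3}
    (h : deviator σ = a • deviator τ) : rhoExc e σ = a * rhoExc e τ := by
  have hρ := rho_eq_mul ha h
  rcases ha.eq_or_lt with rfl | ha
  · rw [rhoExc, hρ]; simp
  · have h2 : J2 σ = a ^ 2 * J2 τ := by
      rw [J2, J2, h, ddot_smul_left, ddot_smul_right]; ring
    have h3 : J3 σ = a ^ 3 * J3 τ := by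
      rw [J3, J3, h, Submodule.coe_smul, smul_pow, Matrix.trace_smul, smul_eq_mul]; ring
    have h0 : 0 ≤ J2 τ := by
      rw [J2, ← rho_sq]; positivity
    have hpow : J2 σ ^ (3 / 2 : ℝ) = a ^ 3 * J2 τ ^ (3 / 2 : ℝ) := by
      rw [h2, Real.mul_rpow (by positivity) h0, ← Real.rpow_natCast, ← Real.rpow_natCast,
        ← Real.rpow_mul ha.le]
      norm_num
    have hθ : lodeAngle σ = lodeAngle τ := by
      rw [lodeAngle, lodeAngle, hpow, h3, mul_div_mul_left _ _ (pow_ne_zero 3 ha.ne')]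
    rw [rhoExc, rhoExc, hρ, hθ]; ring

theorem abs_rhoCos_sub_le (σ τ : Sym3) : |rhoCos σ - rhoCos τ| ≤ 2 * ‖σ - τ‖ := by
  rw [rhoCos, rhoCos, ← mul_sub, abs_mul, abs_of_nonneg (Real.sqrt_nonneg _)]
  have h1 := (abs_topEig_sub_le (deviator σ) (deviator τ))
  rw [← deviator_sub] at h1
  have h2 : √(3 / 2 : ℝ) ≤ 2 := Real.sqrt_le_iff.2 ⟨by norm_num, by norm_num⟩
  exact mul_le_mul h2 (h1.trans (norm_deviator_le _)) (abs_nonneg _) (by norm_num)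

/-- The ratio `rhoCos / rho` is not Lipschitz near `ϱ = 0`, but its variation multiplied by `ϱ` is
at most `3 ‖σ - τ‖`, and it stays in `[1/2, 1]`, where `rExc e` is bounded and Lipschitz. The
constant `4 * L` is `L` for the factor `ϱ` plus `3 * L` for the ratio. -/
theorem exists_lipschitz_rhoExc {e : ℝ} (he : 1 / 2 ≤ e) (he1 : e ≤ 1) :
    ∃ L : ℝ, 0 ≤ L ∧ (∀ σ, rhoExc e σ ≤ L * rho σ) ∧
      ∀ σ τ, |rhoExc e σ - rhoExc e τ| ≤ L * ‖σ - τ‖ := by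
  obtain ⟨L, hL, hbd, hlip⟩ := exists_lipschitz_rExc he he1
  have hub : ∀ σ, rhoExc e σ ≤ L * rho σ := fun σ => by
    rw [rhoExc, mul_comm]
    exact mul_le_mul_of_nonneg_right (hbd _ (cos_lodeAngle_mem σ)) (rho_nonneg σ)
  refine ⟨4 * L, by positivity, fun σ => ?_, fun σ τ => ?_⟩
  · refine (hub σ).trans ?_
    nlinarith [mul_nonneg hL (rho_nonneg σ)]
  · have h1 := abs_rho_sub_le σ τ
    by_cases hσ : rho σ = 0
    · have h2 : rhoExc e σ = 0 := by rw [rhoExc, hσ, zero_mul]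
      rw [h2, zero_sub, abs_neg, abs_of_nonneg (rhoExc_nonneg he he1 τ)]
      rw [hσ, zero_sub, abs_neg, abs_of_nonneg (rho_nonneg τ)] at h1
      refine (hub τ).trans ?_
      nlinarith [mul_le_mul_of_nonneg_left h1 hL, mul_nonneg hL (norm_nonneg (σ - τ))]
    by_cases hτ : rho τ = 0
    · have h2 : rhoExc e τ = 0 := by rw [rhoExc, hτ, zero_mul]
      rw [h2, sub_zero, abs_of_nonneg (rhoExc_nonneg he he1 σ)]
      rw [hτ, sub_zero, abs_of_nonneg (rho_nonneg σ)] at h1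
      refine (hub σ).trans ?_
      nlinarith [mul_le_mul_of_nonneg_left h1 hL, mul_nonneg hL (norm_nonneg (σ - τ))]
    have hσ0 : 0 < rho σ := (rho_nonneg σ).lt_of_ne' hσ
    have hτ0 : 0 < rho τ := (rho_nonneg τ).lt_of_ne' hτ
    have mσ := rhoCos_div_rho_mem hσ
    have mτ := rhoCos_div_rho_mem hτ
    have h2 := hlip _ mσ _ mτ
    have h3 := abs_rhoCos_sub_le σ τ
    have h4 : rho τ * |rhoCos σ / rho σ - rhoCos τ / rho τ| ≤ 3 * ‖σ - τ‖ := by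
      have e1 : rho τ * (rhoCos σ / rho σ - rhoCos τ / rho τ) =
          (rho τ - rho σ) * (rhoCos σ / rho σ) + (rhoCos σ - rhoCos τ) := by
        field_simp
        ring
      rw [← abs_of_pos hτ0, ← abs_mul, abs_of_pos hτ0, e1]
      refine (abs_add_le _ _).trans ?_
      rw [abs_mul, abs_of_nonneg (by linarith [mσ.1] : 0 ≤ rhoCos σ / rho σ), abs_sub_comm (rho τ)]
      have := mul_le_mul h1 mσ.2 (by linarith [mσ.1]) (norm_nonneg _)
      linarith
    have e2 : rhoExc e σ - rhoExc e τ = (rho σ - rho τ) * rExc e (rhoCos σ / rho σ) +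
        rho τ * (rExc e (rhoCos σ / rho σ) - rExc e (rhoCos τ / rho τ)) := by
      rw [rhoExc_eq, rhoExc_eq]; ring
    rw [e2]
    refine (abs_add_le _ _).trans ?_
    rw [abs_mul, abs_mul, abs_of_pos hτ0, abs_of_nonneg (rExc_nonneg he he1 mσ.1)]
    have h5 := mul_le_mul h1 (hbd _ mσ) (rExc_nonneg he he1 mσ.1) (norm_nonneg _)
    have h6 := mul_le_mul_of_nonneg_left h2 hτ0.le
    have h7 := mul_le_mul_of_nonneg_left h4 hL
    nlinarith

theorem chordRegularAt_rhoCos (σ : Sym3) : ChordRegularAt rhoCos σ :=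
  (ChordRegularAt.const _ _).mul <|
    (chordRegularAt_topEig (deviatorCLM σ)).comp
      (ChordRegularAt.of_contDiffAt deviatorCLM.contDiff.contDiffAt)

theorem chordRegularAt_rhoExc {e : ℝ} (he : 1 / 2 ≤ e) (he1 : e ≤ 1) (σ : Sym3) :
    ChordRegularAt (rhoExc e) σ := by
  by_cases h : rho σ = 0
  · obtain ⟨L, -, -, hL⟩ := exists_lipschitz_rhoExc he he1
    refine ChordRegularAt.of_homogeneous one_pos (fun y z _ _ => hL y z) ?_
    intro v s hs
    have hd := rho_eq_zero.1 h
    have h1 : rhoExc e (σ + s • v) = s * rhoExc e (σ + v) := by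
      refine rhoExc_eq_mul hs.1 ?_
      rw [deviator_add, deviator_add, deviator_smul, hd, zero_add, zero_add]
    have h2 : rhoExc e σ = 0 := by rw [rhoExc, h, zero_mul]
    rw [h1, h2, sub_zero, sub_zero, smul_eq_mul]
  · have : rhoExc e = fun τ => rho τ * rExc e (rhoCos τ / rho τ) := funext (rhoExc_eq e)
    rw [this]
    exact (chordRegularAt_rho σ).mul <| ChordRegularAt.comp_contDiffAt
      (contDiffAt_rExc he he1 (rhoCos_div_rho_mem h).1)
      ((chordRegularAt_rhoCos σ).div (chordRegularAt_rho σ) h)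

/-! ### Homogeneous functions of the deviator and their shrinkage under the return. -/

/-- A map of degree one in the deviator, such as `dev` and `ϱ_e`. -/
structure DeviatoricHomogeneous {Y : Type*} [NormedAddCommGroup Y] [NormedSpace ℝ Y]
    (A : Sym3 → Y) : Prop where
  chordRegularAt : ∀ σ, ChordRegularAt A σ
  eq_smul : ∀ ⦃a : ℝ⦄ ⦃σ τ : Sym3⦄, 0 ≤ a → deviator σ = a • deviator τ → A σ = a • A τ
  exists_lipschitz : ∃ L : ℝ, 0 ≤ L ∧ (∀ σ, ‖A σ‖ ≤ L * rho σ) ∧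
    ∀ σ τ, ‖A σ - A τ‖ ≤ L * ‖σ - τ‖

theorem deviatoricHomogeneous_deviator : DeviatoricHomogeneous deviator where
  chordRegularAt σ := ChordRegularAt.of_contDiffAt deviatorCLM.contDiff.contDiffAt
  eq_smul _ _ _ _ h := h
  exists_lipschitz := ⟨1, zero_le_one, fun σ => (one_mul (rho σ)).ge, fun σ τ => by
    rw [← deviator_sub, one_mul]; exact norm_deviator_le _⟩

theorem deviatoricHomogeneous_rho : DeviatoricHomogeneous rho where
  chordRegularAt := chordRegularAt_rho
  eq_smul _ _ _ ha h := rho_eq_mul ha h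
  exists_lipschitz := ⟨1, zero_le_one, fun σ => by
    rw [one_mul, Real.norm_of_nonneg (rho_nonneg σ)], fun σ τ => by
    rw [one_mul]; exact abs_rho_sub_le σ τ⟩

theorem deviatoricHomogeneous_rhoExc {e : ℝ} (he : 1 / 2 ≤ e) (he1 : e ≤ 1) :
    DeviatoricHomogeneous (rhoExc e) where
  chordRegularAt := chordRegularAt_rhoExc he he1
  eq_smul _ _ _ ha h := rhoExc_eq_mul ha h
  exists_lipschitz := by
    obtain ⟨L, h0, h1, h2⟩ := exists_lipschitz_rhoExc he he1
    exact ⟨L, h0, fun σ => by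
      rw [Real.norm_of_nonneg (rhoExc_nonneg he he1 σ)]; exact h1 σ, h2⟩


/-- The factor by which the deviator is scaled in the implicit return with plastic multiplier `t`,
when the flow rule prescribes the deviatoric rate `b + c ϱ`. -/
def returnFactor (b c : ℝ) (q : Sym3 × ℝ) : ℝ :=
  max (rho q.1 - b * max q.2 0) 0 / rho q.1 * (1 + c * max q.2 0)⁻¹

theorem returnFactor_nonneg {b c : ℝ} (hc : 0 ≤ c) (q : Sym3 × ℝ) : 0 ≤ returnFactor b c q := by
  have := rho_nonneg q.1
  unfold returnFactor
  positivity

theorem returnFactor_anti {b c : ℝ} (hb : 0 ≤ b) (hc : 0 ≤ c) (z : Sym3) {t u : ℝ}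
    (h : max t 0 ≤ max u 0) : returnFactor b c (z, u) ≤ returnFactor b c (z, t) := by
  have := rho_nonneg z
  unfold returnFactor
  dsimp only
  gcongr

section Lipschitz

variable {Y : Type*} [NormedAddCommGroup Y] [NormedSpace ℝ Y] {A : Sym3 → Y} {L : ℝ}

theorem norm_shrink_sub_le_of_le (hL : 0 ≤ L) (hA : ∀ σ, ‖A σ‖ ≤ L * rho σ)
    {m : ℝ} (hm : 0 ≤ m) {σ τ : Sym3} (hσ : m < rho σ) (hτ : rho τ ≤ m) :
    ‖(max (rho σ - m) 0 / rho σ) • A σ - (max (rho τ - m) 0 / rho τ) • A τ‖ ≤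
      2 * L * ‖σ - τ‖ := by
  have hσ0 : 0 < rho σ := hm.trans_lt hσ
  rw [max_eq_left (by linarith), max_eq_right (by linarith : rho τ - m ≤ 0), zero_div, zero_smul,
    sub_zero, norm_smul, Real.norm_of_nonneg (div_nonneg (by linarith) hσ0.le)]
  have h1 := (le_abs_self _).trans (abs_rho_sub_le σ τ)
  calc (rho σ - m) / rho σ * ‖A σ‖ ≤ (rho σ - m) / rho σ * (L * rho σ) := by
        have : 0 ≤ rho σ - m := by linarith
        gcongr
        exact hA σ
    _ = L * (rho σ - m) := by field_simp
    _ ≤ L * ‖σ - τ‖ := by gcongr; linarith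
    _ ≤ 2 * L * ‖σ - τ‖ := by nlinarith [mul_nonneg hL (norm_nonneg (σ - τ))]

/-- The bound `‖A σ‖ ≤ L * rho σ` compensates the division by `ϱ`, which makes the Lipschitz
constant independent of the threshold `m`. -/
theorem norm_shrink_sub_le (hL : 0 ≤ L) (hA : ∀ σ, ‖A σ‖ ≤ L * rho σ)
    (hlip : ∀ σ τ, ‖A σ - A τ‖ ≤ L * ‖σ - τ‖) {m : ℝ} (hm : 0 ≤ m) (σ τ : Sym3) :
    ‖(max (rho σ - m) 0 / rho σ) • A σ - (max (rho τ - m) 0 / rho τ) • A τ‖ ≤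
      2 * L * ‖σ - τ‖ := by
  rcases le_or_gt (rho σ) m with hσ | hσ
  · rcases le_or_gt (rho τ) m with hτ | hτ
    · rw [max_eq_right (by linarith), max_eq_right (by linarith)]
      simp only [zero_div, zero_smul, sub_self, norm_zero]
      positivity
    · rw [norm_sub_rev, norm_sub_rev σ]
      exact norm_shrink_sub_le_of_le hL hA hm hτ hσ
  · rcases le_or_gt (rho τ) m with hτ | hτ
    · exact norm_shrink_sub_le_of_le hL hA hm hσ hτ
    have hσ0 : 0 < rho σ := hm.trans_lt hσ
    have hτ0 : 0 < rho τ := hm.trans_lt hτ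
    rw [max_eq_left (by linarith), max_eq_left (by linarith)]
    have e : ((rho σ - m) / rho σ) • A σ - ((rho τ - m) / rho τ) • A τ =
        ((rho σ - m) / rho σ) • (A σ - A τ) +
          (m / rho σ * ((rho σ - rho τ) / rho τ)) • A τ := by
      have : m / rho σ * ((rho σ - rho τ) / rho τ) =
          (rho σ - m) / rho σ - (rho τ - m) / rho τ := by
        field_simp
        ring
      rw [this]
      module
    have h1 : (rho σ - m) / rho σ ≤ 1 := (div_le_one hσ0).2 (by linarith)
    have h2 : 0 ≤ (rho σ - m) / rho σ := div_nonneg (by linarith) hσ0.le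
    have h3 : m / rho σ ≤ 1 := (div_le_one hσ0).2 hσ.le
    have h4 : 0 ≤ m / rho σ := by positivity
    rw [e]
    refine (norm_add_le _ _).trans ?_
    rw [norm_smul, norm_smul, Real.norm_of_nonneg h2, Real.norm_eq_abs, abs_mul,
      abs_of_nonneg h4, abs_div, abs_of_pos hτ0]
    have h5 : (rho σ - m) / rho σ * ‖A σ - A τ‖ ≤ 1 * (L * ‖σ - τ‖) :=
      mul_le_mul h1 (hlip σ τ) (norm_nonneg _) zero_le_one
    have h6 : |rho σ - rho τ| / rho τ * ‖A τ‖ ≤ L * ‖σ - τ‖ := by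
      calc |rho σ - rho τ| / rho τ * ‖A τ‖ ≤ |rho σ - rho τ| / rho τ * (L * rho τ) := by
            gcongr
            exact hA τ
        _ = L * |rho σ - rho τ| := by field_simp
        _ ≤ L * ‖σ - τ‖ := by gcongr; exact abs_rho_sub_le σ τ
    have h7 : m / rho σ * (|rho σ - rho τ| / rho τ) * ‖A τ‖ ≤ 1 * (L * ‖σ - τ‖) := by
      rw [mul_assoc]
      exact mul_le_mul h3 h6 (by positivity) zero_le_one
    linarith

theorem norm_shrink_sub_le' (hL : 0 ≤ L) (hA : ∀ σ, ‖A σ‖ ≤ L * rho σ) (σ : Sym3) (m k : ℝ) :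
    ‖(max (rho σ - m) 0 / rho σ) • A σ - (max (rho σ - k) 0 / rho σ) • A σ‖ ≤ L * |m - k| := by
  rw [← sub_smul, ← sub_div, norm_smul, Real.norm_eq_abs, abs_div, abs_of_nonneg (rho_nonneg σ)]
  have h1 : |max (rho σ - m) 0 - max (rho σ - k) 0| ≤ |m - k| := by
    refine (abs_max_sub_max_le_abs _ _ _).trans (le_of_eq ?_)
    rw [sub_sub_sub_cancel_left, abs_sub_comm]
  by_cases h : rho σ = 0
  · rw [h, div_zero, zero_mul]; positivity
  have hσ0 : 0 < rho σ := (rho_nonneg σ).lt_of_ne' h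
  calc |max (rho σ - m) 0 - max (rho σ - k) 0| / rho σ * ‖A σ‖
      ≤ |m - k| / rho σ * (L * rho σ) := by
        gcongr
        exact hA σ
    _ = L * |m - k| := by field_simp

end Lipschitz

/-- Only points with `ϱ = 0` escape the calculus rules. There, with a negative second component the
map is locally `A`, and with a positive one it is locally zero. At second component zero it is
Lipschitz and positively homogeneous of degree one in the increment. The factor by itself has degree
zero, which is why it is treated together with `A`. -/
theorem chordRegularAt_shrink {Y : Type*} [NormedAddCommGroup Y] [NormedSpace ℝ Y] {A : Sym3 → Y}
    (hA : DeviatoricHomogeneous A) {b : ℝ} (hb : 0 < b) (q : Sym3 × ℝ) :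
    ChordRegularAt (fun q : Sym3 × ℝ =>
      (max (rho q.1 - b * max q.2 0) 0 / rho q.1) • A q.1) q := by
  obtain ⟨L, hL, hbd, hlip⟩ := hA.exists_lipschitz
  have hfst : ChordRegularAt (Prod.fst : Sym3 × ℝ → Sym3) q :=
    ChordRegularAt.of_contDiffAt contDiffAt_fst
  have hsnd : ChordRegularAt (Prod.snd : Sym3 × ℝ → ℝ) q :=
    ChordRegularAt.of_contDiffAt contDiffAt_snd
  have hρ : ChordRegularAt (fun q : Sym3 × ℝ => rho q.1) q := (chordRegularAt_rho q.1).comp hfst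
  have hAq : ChordRegularAt (fun q : Sym3 × ℝ => A q.1) q := (hA.chordRegularAt q.1).comp hfst
  by_cases h : rho q.1 = 0
  · rcases lt_trichotomy q.2 0 with ht | ht | ht
    · refine hAq.congr ?_
      filter_upwards [hsnd.continuousAt.eventually_lt continuousAt_const ht] with r hr
      rw [max_eq_right hr.le, mul_zero, sub_zero, max_eq_left (rho_nonneg _)]
      -- Division by zero makes the factor `0` instead of `1` here; this is harmless because `A r.1`
      -- vanishes.
      by_cases h' : rho r.1 = 0
      · have := hbd r.1
        rw [h', mul_zero] at this
        rw [norm_le_zero_iff.1 this, smul_zero]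
      · rw [div_self h', one_smul]
    · refine ChordRegularAt.of_homogeneous (L := 2 * L + L * b) one_pos ?_ ?_
      · intro y z _ _
        have hy : ‖y.1 - z.1‖ ≤ ‖y - z‖ := norm_fst_le (y - z)
        have hy' : ‖y.2 - z.2‖ ≤ ‖y - z‖ := norm_snd_le (y - z)
        have h1 := norm_shrink_sub_le hL hbd hlip (m := b * max y.2 0) (by positivity) y.1 z.1
        have h2 := norm_shrink_sub_le' hL hbd z.1 (b * max y.2 0) (b * max z.2 0)
        have h3 : |b * max y.2 0 - b * max z.2 0| ≤ b * ‖y - z‖ := by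
          rw [← mul_sub, abs_mul, abs_of_pos hb]
          gcongr
          exact (abs_max_sub_max_le_abs _ _ _).trans hy'
        refine (norm_sub_le_norm_sub_add_norm_sub _ _ _).trans (add_le_add h1 h2) |>.trans ?_
        have h4 := mul_le_mul_of_nonneg_left h3 hL
        have h5 := mul_le_mul_of_nonneg_left hy hL
        nlinarith
      · intro v s hs
        have hd := rho_eq_zero.1 h
        have hdev : deviator (q.1 + s • v.1) = s • deviator (q.1 + v.1) := by
          rw [deviator_add, deviator_add, deviator_smul, hd, zero_add, zero_add]
        simp only [Prod.fst_add, Prod.snd_add, Prod.smul_fst, Prod.smul_snd, h, ht, div_zero,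
          zero_smul, sub_zero, zero_add, smul_eq_mul]
        rw [rho_eq_mul hs.1 hdev, hA.eq_smul hs.1 hdev]
        rcases hs.1.eq_or_lt with rfl | hs0
        · simp
        have e1 : max (s * v.2) 0 = s * max v.2 0 := by
          rw [mul_max_of_nonneg _ _ hs.1, mul_zero]
        have e2 : max (s * rho (q.1 + v.1) - b * (s * max v.2 0)) 0 =
            s * max (rho (q.1 + v.1) - b * max v.2 0) 0 := by
          rw [mul_max_of_nonneg (rho (q.1 + v.1) - b * max v.2 0) 0 hs.1, mul_zero, mul_sub,
            mul_left_comm]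
        rw [e1, e2, mul_div_mul_left _ _ hs0.ne', smul_comm]
    · refine (ChordRegularAt.const (0 : Y) q).congr ?_
      have : rho q.1 < b * q.2 := by rw [h]; positivity
      filter_upwards [hρ.continuousAt.eventually_lt (continuousAt_const.mul hsnd.continuousAt) this]
        with r hr
      have hr' : rho r.1 < b * r.2 := hr
      have h1 : b * r.2 ≤ b * max r.2 0 := by gcongr; exact le_max_left _ _
      rw [max_eq_right (by linarith : rho r.1 - b * max r.2 0 ≤ 0), zero_div, zero_smul]
  · exact ((hρ.sub ((ChordRegularAt.const b q).mul hsnd.posPart)).posPart.div hρ h).smul hAq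

theorem chordRegularAt_returnFactor_smul {Y : Type*} [NormedAddCommGroup Y] [NormedSpace ℝ Y]
    {A : Sym3 → Y} (hA : DeviatoricHomogeneous A) {b c : ℝ} (hb : 0 < b) (hc : 0 ≤ c)
    (q : Sym3 × ℝ) : ChordRegularAt (fun q : Sym3 × ℝ => returnFactor b c q • A q.1) q := by
  have hsnd : ChordRegularAt (Prod.snd : Sym3 × ℝ → ℝ) q :=
    ChordRegularAt.of_contDiffAt contDiffAt_snd
  have hden : ChordRegularAt (fun q : Sym3 × ℝ => (1 + c * max q.2 0)⁻¹) q :=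
    ((ChordRegularAt.const 1 q).add ((ChordRegularAt.const c q).mul hsnd.posPart)).inv
      (by positivity)
  refine (hden.smul (chordRegularAt_shrink hA hb q)).congr (Filter.Eventually.of_forall fun r => ?_)
  simp only [returnFactor]
  rw [smul_smul, mul_comm]


/-! ### Monotone scalar equations and the subdifferential of `ϱ`. -/

theorem exists_zero_of_strongly_monotone {f : ℝ → ℝ} (hf : Continuous f) {c : ℝ} (hc : 0 < c)
    (hmono : ∀ a b, a ≤ b → c * (b - a) ≤ f b - f a) : ∃ x, f x = 0 := by
  set r := |f 0| / c with hr
  have hr0 : 0 ≤ r := by positivity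
  have hcr : c * r = |f 0| := by rw [hr]; field_simp
  have h1 := hmono (-r) 0 (by linarith)
  have h2 := hmono 0 r hr0
  rw [zero_sub, neg_neg, hcr] at h1
  rw [sub_zero, hcr] at h2
  have h3 := le_abs_self (f 0)
  have h4 := neg_abs_le (f 0)
  obtain ⟨x, -, hx⟩ := intermediate_value_Icc (by linarith : -r ≤ r) hf.continuousOn
    (show (0 : ℝ) ∈ Set.Icc (f (-r)) (f r) from ⟨by linarith, by linarith⟩)
  exact ⟨x, hx⟩

/-- Testing the subgradient inequality at `σ + p(n) I`, at `σ + n`, and at `0` and `2σ` yields the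
three conditions in turn. The converse is the Cauchy–Schwarz inequality. -/
theorem mem_subdiffRho_iff {n σ : Sym3} :
    n ∈ subdiffRho σ ↔ pressure n = 0 ∧ ‖n‖ ≤ 1 ∧ ddot n σ = rho σ := by
  constructor
  · intro h
    have hp : pressure n = 0 := by
      have h1 := h (σ + pressure n • idTensor)
      have h2 : rho (σ + pressure n • idTensor) = rho σ := by
        rw [rho, deviator_add, deviator_smul, deviator_id, smul_zero, add_zero, rho]
      rw [add_sub_cancel_left, ddot_smul_right, ddot_comm, ddot_id, h2] at h1
      nlinarith [sq_nonneg (pressure n)]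
    refine ⟨hp, ?_, ?_⟩
    · have h1 := h (σ + n)
      have h2 := rho_add_le σ n
      have h3 := rho_le_norm n
      rw [add_sub_cancel_left, ← norm_sq_eq_ddot] at h1
      by_contra! h4
      nlinarith
    · have h1 := h 0
      have h2 := h ((2 : ℝ) • σ)
      have h3 : (2 : ℝ) • σ - σ = (1 : ℝ) • σ := by module
      have h4 : (0 : Sym3) - σ = (-1 : ℝ) • σ := by module
      have h5 : rho (0 : Sym3) = 0 := by
        have := rho_smul 0 σ
        rwa [zero_smul, abs_zero, zero_mul] at this
      rw [h4, h5, ddot_smul_right] at h1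
      rw [h3, rho_smul, abs_two, ddot_smul_right] at h2
      linarith
  · rintro ⟨hp, hn, hσ⟩ τ
    rw [ddot_sub_right, hσ, ← ddot_deviator_right n τ hp]
    have h1 := ddot_le_norm_mul_norm n (deviator τ)
    have h2 := mul_le_mul_of_nonneg_right hn (norm_nonneg (deviator τ))
    rw [one_mul] at h2
    have h3 : ‖deviator τ‖ = rho τ := rfl
    linarith

/-- Equality case of Cauchy–Schwarz: the squared distance between the two sides is `‖n‖² - 1 ≤ 0`.
-/
theorem eq_smul_deviator_of_mem_subdiffRho {n σ : Sym3} (hn : n ∈ subdiffRho σ)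
    (h : rho σ ≠ 0) : n = (rho σ)⁻¹ • deviator σ := by
  obtain ⟨hp, h1, h2⟩ := mem_subdiffRho_iff.1 hn
  rw [← sub_eq_zero, ← norm_le_zero_iff]
  refine (abs_le_of_sq_le_sq' ?_ le_rfl).2
  rw [norm_sq_eq_ddot, ddot_sub_left, ddot_sub_right, ddot_sub_right, ddot_smul_left,
    ddot_smul_left, ddot_smul_right, ddot_smul_right, ddot_comm (deviator σ) n,
    ddot_deviator_right n σ hp, h2, ← rho_sq, ← norm_sq_eq_ddot, inv_mul_cancel₀ h]
  have h3 : (rho σ)⁻¹ * ((rho σ)⁻¹ * rho σ ^ 2) = 1 := by field_simp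
  rw [h3]
  nlinarith [norm_nonneg n]

/-! ### The return path parametrized by pressure, and the solution of the step. -/

namespace JGModel

variable (M : JGModel)

/-- The part of the deviatoric flow rate that does not depend on `ϱ`. -/
def flowConst : ℝ := 2 * M.G * (M.m0 / (√6 * M.fc))

/-- The slope in `ϱ` of the deviatoric flow rate. -/
def flowSlope : ℝ := 2 * M.G * (3 / M.fc ^ 2)

theorem flowConst_pos : 0 < M.flowConst := by
  have := M.G_pos
  have := M.m0_pos
  have := M.fc_pos
  unfold flowConst
  positivity

theorem flowSlope_pos : 0 < M.flowSlope := by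
  have := M.G_pos
  have := M.fc_pos
  unfold flowSlope
  positivity

theorem two_mul_G_mul_gRho (ϱ : ℝ) : 2 * M.G * M.gRho ϱ = M.flowSlope * ϱ + M.flowConst := by
  rw [gRho, flowSlope, flowConst]; ring

theorem gV_pos (p : ℝ) : 0 < M.gV p := by
  have := M.Ag_pos
  have := M.fc_pos
  unfold gV
  positivity

theorem gV_mono {p q : ℝ} (h : p ≤ q) : M.gV p ≤ M.gV q := by
  have := M.Ag_pos
  have := M.fc_pos
  have := M.Bg_pos
  unfold gV
  gcongr

/-- The plastic multiplier needed to return from the trial stress `z` to the pressure `p`. -/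
def multiplier (q : Sym3 × ℝ) : ℝ := (pressure q.1 - q.2) / (M.K * M.gV q.2)

theorem multiplier_denom_pos (p : ℝ) : 0 < M.K * M.gV p := mul_pos M.K_pos (M.gV_pos p)

theorem eq_multiplier_iff {z : Sym3} {p t : ℝ} :
    t = M.multiplier (z, p) ↔ p = pressure z - t * (M.K * M.gV p) := by
  rw [multiplier, eq_div_iff (M.multiplier_denom_pos p).ne']
  constructor <;> intro h <;> linarith

theorem multiplier_nonneg {z : Sym3} {p : ℝ} (h : p ≤ pressure z) : 0 ≤ M.multiplier (z, p) :=
  div_nonneg (sub_nonneg.2 h) (M.multiplier_denom_pos p).le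

/-- As the pressure grows, the numerator falls and the denominator rises; the quotient is monotone
on this ground only while the numerator is nonnegative, and the clipping at `0` covers the remaining
pressures. -/
theorem multiplier_anti (z : Sym3) {p q : ℝ} (h : p ≤ q) :
    max (M.multiplier (z, q)) 0 ≤ max (M.multiplier (z, p)) 0 := by
  rcases le_total (pressure z) q with hq | hq
  · have : M.multiplier (z, q) ≤ 0 :=
      div_nonpos_of_nonpos_of_nonneg (sub_nonpos.2 hq) (M.multiplier_denom_pos q).le
    rw [max_eq_right this]
    exact le_max_right _ _
  · refine max_le_max ?_ le_rfl
    unfold multiplier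
    refine div_le_div₀ (by dsimp only; linarith) (by dsimp only; linarith)
      (M.multiplier_denom_pos p) ?_
    exact mul_le_mul_of_nonneg_left (M.gV_mono h) M.K_pos.le

theorem chordRegularAt_multiplier (q : Sym3 × ℝ) : ChordRegularAt M.multiplier q := by
  refine ChordRegularAt.of_contDiffAt ?_
  have h1 : ContDiff ℝ 2 fun q : Sym3 × ℝ => pressure q.1 - q.2 :=
    (pressureCLM.contDiff.comp contDiff_fst).sub contDiff_snd
  have h2 : ContDiff ℝ 2 M.gV := by
    unfold gV
    fun_prop
  exact h1.contDiffAt.div (contDiff_const.mul (h2.comp contDiff_snd)).contDiffAt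
    (M.multiplier_denom_pos q.2).ne'

/-- The factor scaling the deviator in the return from the trial stress `z` to the pressure `p`. -/
def pressureFactor (q : Sym3 × ℝ) : ℝ :=
  returnFactor M.flowConst M.flowSlope (q.1, M.multiplier q)

theorem pressureFactor_nonneg (q : Sym3 × ℝ) : 0 ≤ M.pressureFactor q :=
  returnFactor_nonneg M.flowSlope_pos.le _

theorem pressureFactor_mono (z : Sym3) {p q : ℝ} (h : p ≤ q) :
    M.pressureFactor (z, p) ≤ M.pressureFactor (z, q) :=
  returnFactor_anti M.flowConst_pos.le M.flowSlope_pos.le z (M.multiplier_anti z h)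

theorem chordRegularAt_pressureFactor_smul {Y : Type*} [NormedAddCommGroup Y] [NormedSpace ℝ Y]
    {A : Sym3 → Y} (hA : DeviatoricHomogeneous A) (q : Sym3 × ℝ) :
    ChordRegularAt (fun q : Sym3 × ℝ => M.pressureFactor q • A q.1) q :=
  ChordRegularAt.comp (F := fun q : Sym3 × ℝ => (q.1, M.multiplier q))
    (chordRegularAt_returnFactor_smul hA M.flowConst_pos M.flowSlope_pos.le _)
    ((ChordRegularAt.of_contDiffAt contDiffAt_fst).prodMk (M.chordRegularAt_multiplier q))

/-- The stress of pressure `p` on the return path from the trial stress `z`. -/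
def returnStress (q : Sym3 × ℝ) : Sym3 := q.2 • idTensor + M.pressureFactor q • deviator q.1

theorem pressure_returnStress (q : Sym3 × ℝ) : pressure (M.returnStress q) = q.2 := by
  rw [returnStress, pressure_add, pressure_smul, pressure_smul, pressure_id, pressure_deviator]
  ring

theorem deviator_returnStress (q : Sym3 × ℝ) :
    deviator (M.returnStress q) = M.pressureFactor q • deviator q.1 := by
  rw [returnStress, deviator_add, deviator_smul, deviator_smul, deviator_id, deviator_deviator,
    smul_zero, zero_add]

theorem rho_returnStress (q : Sym3 × ℝ) :
    rho (M.returnStress q) = M.pressureFactor q * rho q.1 :=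
  rho_eq_mul (M.pressureFactor_nonneg q) (M.deviator_returnStress q)

theorem yieldFun_returnStress (q : Sym3 × ℝ) :
    M.yieldFun (M.returnStress q) =
      M.yieldHat q.2 (M.pressureFactor q * rho q.1) (M.pressureFactor q * rhoExc M.e q.1) := by
  rw [yieldFun, pressure_returnStress, rho_returnStress,
    rhoExc_eq_mul (M.pressureFactor_nonneg q) (M.deviator_returnStress q)]

theorem chordRegularAt_returnStress (q : Sym3 × ℝ) : ChordRegularAt M.returnStress q :=
  ((ChordRegularAt.of_contDiffAt contDiffAt_snd).smul (ChordRegularAt.const idTensor q)).add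
    (M.chordRegularAt_pressureFactor_smul deviatoricHomogeneous_deviator q)

theorem chordRegularAt_yieldFun_returnStress (q : Sym3 × ℝ) :
    ChordRegularAt (fun q => M.yieldFun (M.returnStress q)) q := by
  have hsnd : ChordRegularAt (Prod.snd : Sym3 × ℝ → ℝ) q :=
    ChordRegularAt.of_contDiffAt contDiffAt_snd
  have h1 := M.chordRegularAt_pressureFactor_smul deviatoricHomogeneous_rho q
  have h2 := M.chordRegularAt_pressureFactor_smul
    (deviatoricHomogeneous_rhoExc M.half_le_e M.e_le_one) q
  have hY : ContDiff ℝ 2 fun r : ℝ × ℝ × ℝ => M.yieldHat r.1 r.2.1 r.2.2 := by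
    unfold yieldHat
    fun_prop
  refine (ChordRegularAt.comp (F := fun q : Sym3 × ℝ => (q.2, M.pressureFactor q • rho q.1,
    M.pressureFactor q • rhoExc M.e q.1)) (ChordRegularAt.of_contDiffAt hY.contDiffAt)
    (hsnd.prodMk (h1.prodMk h2))).congr (Filter.Eventually.of_forall fun r => ?_)
  exact (M.yieldFun_returnStress r).symm

/-- The terms in `ϱ` and `ϱ_e` are nondecreasing because `pressureFactor` is; the term linear in the
pressure supplies the modulus. -/
theorem yieldFun_returnStress_mono (z : Sym3) (p q : ℝ) (h : p ≤ q) :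
    M.m0 / M.fc * (q - p) ≤
      M.yieldFun (M.returnStress (z, q)) - M.yieldFun (M.returnStress (z, p)) := by
  have hm := M.m0_pos
  have hf := M.fc_pos
  have h0 := M.pressureFactor_nonneg (z, p)
  have hρ := rho_nonneg z
  have h1 : M.pressureFactor (z, p) * rho z ≤ M.pressureFactor (z, q) * rho z :=
    mul_le_mul_of_nonneg_right (M.pressureFactor_mono z h) hρ
  have h2 : M.pressureFactor (z, p) * rhoExc M.e z ≤ M.pressureFactor (z, q) * rhoExc M.e z :=
    mul_le_mul_of_nonneg_right (M.pressureFactor_mono z h)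
      (rhoExc_nonneg M.half_le_e M.e_le_one z)
  rw [yieldFun_returnStress, yieldFun_returnStress, yieldHat, yieldHat]
  dsimp only
  have h3 : 3 / 2 * (M.pressureFactor (z, p) * rho z / M.fc) ^ 2 ≤
      3 / 2 * (M.pressureFactor (z, q) * rho z / M.fc) ^ 2 := by gcongr
  have h4 : M.m0 * (M.pressureFactor (z, p) * rhoExc M.e z / (√6 * M.fc)) ≤
      M.m0 * (M.pressureFactor (z, q) * rhoExc M.e z / (√6 * M.fc)) := by gcongr
  have h5 : M.m0 / M.fc * (q - p) = M.m0 * (q / M.fc) - M.m0 * (p / M.fc) := by ring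
  rw [h5]
  linarith

theorem m0_div_fc_pos : 0 < M.m0 / M.fc := div_pos M.m0_pos M.fc_pos

theorem exists_yieldPressure (z : Sym3) : ∃ p, M.yieldFun (M.returnStress (z, p)) = 0 := by
  refine exists_zero_of_strongly_monotone ?_ M.m0_div_fc_pos (M.yieldFun_returnStress_mono z)
  refine continuous_iff_continuousAt.2 fun p => ?_
  exact ContinuousAt.comp (f := fun p : ℝ => (z, p))
    (M.chordRegularAt_yieldFun_returnStress (z, p)).continuousAt (by fun_prop)

/-- The pressure at which the return path meets the yield surface. -/
def yieldPressure (z : Sym3) : ℝ := (M.exists_yieldPressure z).choose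

theorem yieldFun_yieldPressure (z : Sym3) :
    M.yieldFun (M.returnStress (z, M.yieldPressure z)) = 0 :=
  (M.exists_yieldPressure z).choose_spec

theorem yieldFun_returnStress_nonpos_iff {z : Sym3} {p : ℝ} :
    M.yieldFun (M.returnStress (z, p)) ≤ 0 ↔ p ≤ M.yieldPressure z := by
  have h0 := M.yieldFun_yieldPressure z
  have hc := M.m0_div_fc_pos
  constructor
  · intro h
    by_contra! hlt
    have h1 := M.yieldFun_returnStress_mono z _ _ hlt.le
    have := mul_pos hc (sub_pos.2 hlt)
    linarith
  · intro h
    have h1 := M.yieldFun_returnStress_mono z _ _ h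
    have := mul_nonneg hc.le (sub_nonneg.2 h)
    linarith

theorem eq_yieldPressure {z : Sym3} {p : ℝ} (h : M.yieldFun (M.returnStress (z, p)) = 0) :
    p = M.yieldPressure z := by
  refine le_antisymm (M.yieldFun_returnStress_nonpos_iff.1 h.le) ?_
  by_contra! hlt
  have h1 := M.yieldFun_returnStress_mono z _ _ hlt.le
  rw [h, M.yieldFun_yieldPressure, sub_zero] at h1
  exact absurd h1 (mul_pos M.m0_div_fc_pos (sub_pos.2 hlt)).not_ge

theorem chordRegularAt_yieldPressure (z : Sym3) : ChordRegularAt M.yieldPressure z :=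
  ChordRegularAt.implicit (H := fun q => M.yieldFun (M.returnStress q)) M.m0_div_fc_pos
    M.yieldFun_returnStress_mono M.yieldFun_yieldPressure
    (M.chordRegularAt_yieldFun_returnStress _)

/-- The pressure of the updated stress, as a function of the trial stress. -/
def updatedPressure (z : Sym3) : ℝ := min (pressure z) (M.yieldPressure z)

/-- The updated stress, as a function of the trial stress. -/
def updatedStress (z : Sym3) : Sym3 := M.returnStress (z, M.updatedPressure z)

theorem chordRegularAt_updatedStress (z : Sym3) : ChordRegularAt M.updatedStress z :=
  ChordRegularAt.comp (F := fun z : Sym3 => (z, M.updatedPressure z))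
    (M.chordRegularAt_returnStress _)
    ((ChordRegularAt.of_contDiffAt contDiffAt_id).prodMk
      ((ChordRegularAt.of_contDiffAt pressureCLM.contDiff.contDiffAt).min
        (M.chordRegularAt_yieldPressure z)))

/-- Subgradients have zero pressure, so the volumetric part fixes `t`. If `ϱ(σ) ≠ 0`, the
subgradient is the normalized deviator and the deviatoric part is a scalar linear equation for
`ϱ(σ)`. If `ϱ(σ) = 0`, the bound `‖n‖ ≤ 1` forces `ϱ(z) ≤ flowConst * t`, which is exactly when the
factor is clipped to zero. -/
theorem eq_returnStress_of_flow {z σ n : Sym3} {t : ℝ} (ht : 0 ≤ t) (hn : n ∈ subdiffRho σ)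
    (h : σ = z - t • ((M.K * M.gV (pressure σ)) • idTensor + (2 * M.G * M.gRho (rho σ)) • n)) :
    t = M.multiplier (z, pressure σ) ∧ σ = M.returnStress (z, pressure σ) := by
  have hpn := (mem_subdiffRho_iff.1 hn).1
  have hp : t = M.multiplier (z, pressure σ) := by
    rw [eq_multiplier_iff]
    have := congrArg pressure h
    rw [pressure_sub, pressure_smul, pressure_add, pressure_smul, pressure_smul, hpn,
      pressure_id] at this
    linarith
  refine ⟨hp, ext_pressure_deviator (M.pressure_returnStress (z, pressure σ)).symm ?_⟩
  have hdn : deviator n = n := by rw [deviator, hpn, zero_smul, sub_zero]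
  have hd : deviator z = deviator σ + (t * (M.flowSlope * rho σ + M.flowConst)) • n := by
    have := congrArg deviator h
    rw [deviator_sub, deviator_smul, deviator_add, deviator_smul, deviator_smul, hdn,
      deviator_id, smul_zero, zero_add, smul_smul, two_mul_G_mul_gRho] at this
    rw [this]
    abel
  have hb := M.flowConst_pos
  have hc := M.flowSlope_pos
  rw [deviator_returnStress, pressureFactor, ← hp, returnFactor]
  dsimp only
  rw [max_eq_left ht]
  by_cases h0 : rho σ = 0
  · have hd0 := rho_eq_zero.1 h0
    rw [hd0, zero_add, h0, mul_zero, zero_add] at hd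
    have hρ : rho z ≤ M.flowConst * t := by
      rw [rho, hd, norm_smul, Real.norm_of_nonneg (by positivity), mul_comm t]
      exact mul_le_of_le_one_right (by positivity) (mem_subdiffRho_iff.1 hn).2.1
    rw [hd0, max_eq_right (by linarith), zero_div, zero_mul, zero_smul]
  · have hρ : 0 < rho σ := (rho_nonneg σ).lt_of_ne' h0
    have hn' := eq_smul_deviator_of_mem_subdiffRho hn h0
    set w := 1 + t * (M.flowSlope * rho σ + M.flowConst) / rho σ with hw
    have hw0 : 0 < w := by positivity
    have hd' : deviator z = w • deviator σ := by
      rw [hd, hn', smul_smul, hw, add_smul, one_smul, div_eq_mul_inv]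
    have hρz : rho z = w * rho σ := rho_eq_mul hw0.le hd'
    have e1 : w * rho σ - M.flowConst * t = rho σ * (1 + M.flowSlope * t) := by
      rw [hw]
      field_simp
      ring
    have e2 : 0 < 1 + M.flowSlope * t := by positivity
    rw [hρz, e1, max_eq_left (by positivity), hd', smul_smul]
    have e3 : rho σ * (1 + M.flowSlope * t) / (w * rho σ) * (1 + M.flowSlope * t)⁻¹ * w = 1 := by
      field_simp
    rw [e3, one_smul]

/-- The subgradient is sought as `a • deviator z`. On the smooth part `a = 1 / ϱ(z)`. At the apex `a
= 1 / (flowConst * t)` cancels the whole trial deviator, and its norm is admissible because `ϱ(z) ≤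
flowConst * t`. -/
theorem exists_flow_of_eq_multiplier {z : Sym3} {p t : ℝ} (ht : 0 ≤ t)
    (h : t = M.multiplier (z, p)) :
    ∃ n ∈ subdiffRho (M.returnStress (z, p)), M.returnStress (z, p) =
      z - t • ((M.K * M.gV (pressure (M.returnStress (z, p)))) • idTensor +
        (2 * M.G * M.gRho (rho (M.returnStress (z, p)))) • n) := by
  have hb := M.flowConst_pos
  have hc := M.flowSlope_pos
  set σ := M.returnStress (z, p) with hσ
  have hpσ : pressure σ = p := M.pressure_returnStress _
  have hdσ : deviator σ = M.pressureFactor (z, p) • deviator z := M.deviator_returnStress _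
  have hρσ : rho σ = M.pressureFactor (z, p) * rho z := M.rho_returnStress _
  have hκ : M.pressureFactor (z, p) =
      max (rho z - M.flowConst * t) 0 / rho z * (1 + M.flowSlope * t)⁻¹ := by
    rw [pressureFactor, ← h, returnFactor]
    dsimp only
    rw [max_eq_left ht]
  have reduce : ∀ a : ℝ, ‖a • deviator z‖ ≤ 1 → a * ddot (deviator z) σ = rho σ →
      deviator σ = deviator z - (t * (M.flowSlope * rho σ + M.flowConst) * a) • deviator z →
      ∃ n ∈ subdiffRho σ, σ = z - t • ((M.K * M.gV (pressure σ)) • idTensor +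
        (2 * M.G * M.gRho (rho σ)) • n) := by
    intro a h1 h2 h3
    refine ⟨a • deviator z, mem_subdiffRho_iff.2 ⟨?_, h1, ?_⟩, ext_pressure_deviator ?_ ?_⟩
    · rw [pressure_smul, pressure_deviator, mul_zero]
    · rw [ddot_smul_left, h2]
    · rw [pressure_sub, pressure_smul, pressure_add, pressure_smul, pressure_smul, pressure_smul,
        pressure_deviator, pressure_id, hpσ, mul_zero, mul_zero, add_zero, mul_one]
      exact M.eq_multiplier_iff.1 h
    · rw [deviator_sub, deviator_smul, deviator_add, deviator_smul, deviator_smul, deviator_smul,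
        deviator_deviator, deviator_id, smul_zero, zero_add, two_mul_G_mul_gRho, h3, smul_smul,
        smul_smul, mul_assoc t]
  have hddot : ddot (deviator z) σ = M.pressureFactor (z, p) * rho z ^ 2 := by
    rw [← ddot_deviator_right _ _ (pressure_deviator z), hdσ, ddot_smul_right, ← rho_sq]
  rcases lt_or_ge (M.flowConst * t) (rho z) with hlt | hge
  · have hρ0 : 0 < rho z := lt_of_le_of_lt (by positivity) hlt
    rw [max_eq_left (by linarith)] at hκ
    refine reduce (rho z)⁻¹ ?_ ?_ ?_
    · rw [norm_smul, norm_inv, Real.norm_of_nonneg hρ0.le]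
      exact (inv_mul_cancel₀ hρ0.ne').le
    · rw [hddot, hρσ]
      field_simp
    · have e : M.pressureFactor (z, p) =
          1 - t * (M.flowSlope * rho σ + M.flowConst) * (rho z)⁻¹ := by
        have e2 : 0 < 1 + M.flowSlope * t := by positivity
        rw [hρσ, hκ]
        field_simp
        ring
      rw [hdσ, e]
      module
  · rw [max_eq_right (by linarith), zero_div, zero_mul] at hκ
    rw [hκ, zero_mul] at hρσ
    rw [hκ, zero_smul] at hdσ
    rw [hκ, zero_mul] at hddot
    refine reduce (M.flowConst * t)⁻¹ ?_ ?_ ?_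
    · rw [norm_smul, norm_inv, Real.norm_of_nonneg (by positivity)]
      exact inv_mul_le_one_of_le₀ hge (by positivity)
    · rw [hddot, hρσ, mul_zero]
    · rw [hdσ, hρσ, mul_zero, zero_add, mul_comm t]
      -- For `t = 0` the inverse is the default `0`, but then the trial deviator is already zero.
      rcases ht.eq_or_lt with rfl | ht0
      · have : deviator z = 0 := by
          rw [mul_zero] at hge
          exact rho_eq_zero.1 (le_antisymm hge (rho_nonneg z))
        rw [this, smul_zero, sub_zero]
      · rw [mul_inv_cancel₀ (by positivity), one_smul, sub_self]

/-- Nonnegativity of the multiplier means `p ≤ pressure z`, and admissibility means `p ≤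
yieldPressure z`. Complementarity makes one of them an equality, so `p` is the minimum of the two.
-/
theorem isStepSolution_iff {εp ε σ : Sym3} {t : ℝ} :
    M.IsStepSolution εp ε σ t ↔ σ = M.updatedStress (M.trialStress εp ε) ∧
      t = M.multiplier (M.trialStress εp ε, M.updatedPressure (M.trialStress εp ε)) := by
  set z := M.trialStress εp ε with hz
  constructor
  · rintro ⟨⟨n, hn, hflow⟩, ht, hy, hcomp⟩
    obtain ⟨h1, h2⟩ := M.eq_returnStress_of_flow ht hn hflow
    have hy' : pressure σ ≤ M.yieldPressure z := by
      rw [← yieldFun_returnStress_nonpos_iff, ← h2]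
      exact hy
    have hp := M.eq_multiplier_iff.1 h1
    have hpz : pressure σ ≤ pressure z := by
      have := mul_nonneg ht (M.multiplier_denom_pos (pressure σ)).le
      linarith
    have hmin : M.updatedPressure z = pressure σ := by
      rcases mul_eq_zero.1 hcomp with h0 | h0
      · rw [h0, zero_mul, sub_zero] at hp
        rw [updatedPressure, ← hp, min_eq_left hy']
      · rw [h2] at h0
        rw [updatedPressure, ← M.eq_yieldPressure h0, min_eq_right hpz]
    rw [updatedStress, hmin]
    exact ⟨h2, h1⟩
  · rintro ⟨rfl, ht⟩
    have ht0 : 0 ≤ t := ht ▸ M.multiplier_nonneg (min_le_left _ _)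
    refine ⟨M.exists_flow_of_eq_multiplier ht0 ht, ht0,
      M.yieldFun_returnStress_nonpos_iff.2 (min_le_right _ _), ?_⟩
    rcases min_choice (pressure z) (M.yieldPressure z) with h | h
    · have : t = 0 := by rw [ht, updatedPressure, h, multiplier, sub_self, zero_div]
      rw [this, zero_mul]
    · rw [updatedStress, updatedPressure, h, M.yieldFun_yieldPressure, mul_zero]

theorem stressStrain_eq (εp ε : Sym3) :
    M.stressStrain εp ε = M.updatedStress (M.trialStress εp ε) := by
  have h : ∃ σ : Sym3, ∃ Δl : ℝ, M.IsStepSolution εp ε σ Δl :=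
    ⟨_, _, M.isStepSolution_iff.2 ⟨rfl, rfl⟩⟩
  obtain ⟨t, ht⟩ := Classical.epsilon_spec h
  exact (M.isStepSolution_iff.1 ht).1

theorem contDiff_trialStress (εp : Sym3) : ContDiff ℝ 2 (M.trialStress εp) := by
  have h : M.trialStress εp = fun ε =>
      (M.K * (3 * pressureCLM (ε - εp))) • idTensor + (2 * M.G) • deviatorCLM (ε - εp) := by
    funext ε
    rw [trialStress, elastic, ddot_id, pressureCLM_apply, deviatorCLM_apply]
  rw [h]
  fun_prop

end JGModel

end Plasticity

end

theorem mainTheorem5 (M : Plasticity.JGModel) (εp : Plasticity.Sym3) :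
    (∀ ε : Plasticity.Sym3,
      ∃! x : Plasticity.Sym3 × ℝ, M.IsStepSolution εp ε x.1 x.2) ∧
    Semismooth.StronglySemismoothOn (M.stressStrain εp) Set.univ := by
  refine ⟨fun ε => ⟨(_, _), M.isStepSolution_iff.2 ⟨rfl, rfl⟩, fun x hx => ?_⟩, fun ε _ => ?_⟩
  · obtain ⟨h1, h2⟩ := M.isStepSolution_iff.1 hx
    exact Prod.ext h1 h2
  · rw [funext (M.stressStrain_eq εp)]
    exact ((M.chordRegularAt_updatedStress _).comp
      (.of_contDiffAt (M.contDiff_trialStress εp).contDiffAt)).stronglySemismoothAt
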